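/- Let $d\ge 2$ be an integer and let $r\in[1,\infty]$ satisfy $r\ge \frac{2d+2}{d-1}$. Then there is a constant $C<\infty$, depending only on $d$ and $r$, such that the following holds. Let $\mathbb F_q$ be a finite field of odd characteristic with $q$ elements, let $\chi$ be a non-trivial additive character of $\mathbb F_q$, let $Q(x)=\sum_{i,k=1}^d a_{ik}x_ix_k$ with $a_{ik}=a_{ki}\in\mathbb F_q$ be a quadratic form whose matrix $(a_{ik})$ is invertible, let $j\in\mathbb F_q\setminus\{0\}$, and put $S_j=\{x\in\mathbb F_q^d: Q(x)=j\}$. For $f:S_j\to\mathbb C$ and $m\in\mathbb F_q^d$ write $$\widehat{f\,d\sigma}(m)=\frac1{\#S_j}\sum_{x\in S_j}\chi(-x\cdot m)f(x),\qquad \|f\|_{L^2(S_j,d\sigma)}=\Big(\frac1{\#S_j}\sum_{x\in S_j}|f(x)|^2\Big)^{1/2},$$ and, for $g:\mathbb F_q^d\to\mathbb C$, $\|g\|_{L^r(\mathbb F_q^d,dm)}=\big(\sum_{m\in\mathbb F_q^d}|g(m)|^r\big)^{1/r}$ (the maximum of $|g|$ if $r=\infty$). Let $R^*(2\to r)$ be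 the best constant in the inequality $$\|\widehat{f\,d\sigma}\|_{L^r(\mathbb F_q^d,dm)}\le R^*(2\to r)\,\|f\|_{L^2(S_j,d\sigma)}\qquad\text{for all } f:S_j\to\mathbb C .$$ Then $R^*(2\to r)\le C$. -/

import Mathlib

open scoped ENNReal NNReal

namespace FiniteFieldExtension

/-- The `L^p` norm of `g : X → ℂ` on a finite set `X` all of whose points have mass `w`:
`(w * ∑ x, |g x| ^ p) ^ (1 / p)` for finite `p`, and the maximum of `|g|` for `p = ∞`.
It is meant for exponents `1 ≤ p ≤ ∞`. -/
noncomputable def weightedLpNorm {X : Type*} [Fintype X] (w : ℝ) (p : ℝ≥0∞) (g : X → ℂ) : ℝ :=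
  if p = ∞ then ⨆ x, ‖g x‖
  else (w * ∑ x, ‖g x‖ ^ p.toReal) ^ (1 / p.toReal)

section
variable {F : Type*} [Field F] [Fintype F] {d : ℕ}

/-- The homogeneous quadratic polynomial `Q(x) = ∑ a_{ik} x_i x_k` with coefficient matrix `A`. -/
def quadForm (A : Matrix (Fin d) (Fin d) F) (x : Fin d → F) : F :=
  ∑ i, ∑ k, A i k * x i * x k

open Classical in
/-- The quadratic surface `S_j = {x ∈ F^d : Q(x) = j}`. -/
noncomputable def quadSurface (A : Matrix (Fin d) (Fin d) F) (j : F) : Finset (Fin d → F) :=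
  {x | quadForm A x = j}

/-- The extension operator: the Fourier transform of `f dσ`, where `dσ` is the normalized surface
measure on `S`. -/
noncomputable def extension (χ : AddChar F ℂ) (S : Finset (Fin d → F)) (f : S → ℂ)
    (m : Fin d → F) : ℂ :=
  (S.card : ℂ)⁻¹ * ∑ x : S, χ (-((x : Fin d → F) ⬝ᵥ m)) * f x

/-- The extension estimate `‖(f dσ)^‖_{L^r(F^d, dm)} ≤ C ‖f‖_{L^p(S, dσ)}` for all `f : S → ℂ`,
with `dm` the counting measure and `dσ` the normalized counting measure on `S`. -/
def ExtensionEstimate (χ : AddChar F ℂ) (S : Finset (Fin d → F)) (p r : ℝ≥0∞) (C : ℝ≥0) : Prop :=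
  ∀ f : S → ℂ,
    weightedLpNorm 1 r (extension χ S f) ≤ C * weightedLpNorm (S.card : ℝ)⁻¹ p f

/-- `R*(p → r)`: the best constant in the extension estimate (`∞` if no constant works). -/
noncomputable def bestConst (χ : AddChar F ℂ) (S : Finset (Fin d → F)) (p r : ℝ≥0∞) : ℝ≥0∞ :=
  ⨅ (C : ℝ≥0) (_ : ExtensionEstimate χ S p r C), (C : ℝ≥0∞)

end

end FiniteFieldExtension

/-! The extension estimate for `S = {Q = j}` follows from two exponential sum facts, neither of
which needs a pointwise bound for Kloosterman sums.

Write `q` for the order of the field. Completing the square, the Fourier transform of the indicator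
of `S` is, up to the factor `1 / q`, a point mass `q ^ d` at the origin plus `Kl (Q* (m) / 4)`, where
`Q*` has the inverse matrix and `Kl` is a Kloosterman or Salié sum weighted by the Gauss sums of `Q`
(`card_mul_sum_quadSurface`). Dilations by squares move `Kl` from the parameter `j` to `c ^ 2 * j`,
so moments of `Kl` at a fixed `j ≠ 0` are controlled by moments over all parameters. This gives
`#S ≥ q ^ (d - 1) / 10` (`card_pow_le_mul_card_quadSurface`), and, by counting the solutions of
`t + u = t' + u'`, `1/t + 1/u = 1/t' + 1/u'`, the optimal fourth moment
`∑ b, |Kl b| ^ 4 ≤ 9 q ^ (2 d + 3)` (`sum_norm_kloostermanSum_pow_four_le`).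

For `d = 2, 3` the exponent `(2 d + 2) / (d - 1)` is at least `4`, and the `L² → L⁴` estimate is a
bound for the additive energy of `S`. It holds because for `ξ ≠ 0` the intersection of `S` with
`ξ - S` has at most `2 q ^ (d - 2)` points (`card_sq_mul_card_inter_reflection_le`).

For `d ≥ 4` the exponent lies strictly between `2` and `4`. By duality the size of the extension of
`f` on a set `E` of `n` points is controlled by the restriction to `S` of the Fourier transform of a
function bounded by the indicator of `E`. Besides the trivial bound from Plancherel's identity, there
is a second one for `n ≤ q ^ ((d + 1) / 2)`, obtained by pairing `Kl` with the autocorrelation of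
that function along the level sets of `Q*`: Hölder's inequality uses the fourth moment of `Kl` and
the `L¹` and `L²` norms of the autocorrelation (`restriction_estimate`). Applied to the level sets of
the extension, these bounds dominate its decreasing rearrangement by two powers of `n` that cross at
`n = q ^ ((d + 1) / 2)`. Since the exponent is strictly between `2` and `4`, both sides of the
crossing sum to a constant (`sum_range_le_of_two_regimes`), so no interpolation theorem is needed. -/

namespace FiniteFieldExtension

open scoped Matrix ComplexConjugate

/-! ### Plancherel-type identities -/

/-- If the inner products of the vectors `k · y` are `D` or `0` according to whether the indices are
`P`-related, then the square norm of a combination of them is `D` times the `P`-related part of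
the double sum of the coefficients. -/
theorem sum_norm_sq_eq_of_orthogonal {M Y : Type*} [Fintype M] [Fintype Y] (k : M → Y → ℂ) (D : ℝ)
    (P : Y → Y → Prop) [DecidableRel P]
    (h : ∀ y y', ∑ m, k m y * conj (k m y') = if P y y' then (D : ℂ) else 0) (w : Y → ℂ) :
    ((∑ m, ‖∑ y, k m y * w y‖ ^ 2 : ℝ) : ℂ)
      = D * ∑ y, ∑ y', if P y y' then w y * conj (w y') else 0 := by
  have h1 : ∀ m, ((‖∑ y, k m y * w y‖ ^ 2 : ℝ) : ℂ)
      = ∑ y, ∑ y', (k m y * conj (k m y')) * (w y * conj (w y')) := by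
    intro m
    rw [Complex.ofReal_pow, ← Complex.mul_conj', map_sum, Finset.sum_mul_sum]
    refine Finset.sum_congr rfl fun y _ => Finset.sum_congr rfl fun y' _ => ?_
    rw [map_mul]; ring
  rw [Complex.ofReal_sum, Finset.sum_congr rfl fun m _ => h1 m, Finset.sum_comm, Finset.mul_sum]
  refine Finset.sum_congr rfl fun y _ => ?_
  rw [Finset.sum_comm, Finset.mul_sum]
  refine Finset.sum_congr rfl fun y' _ => ?_
  rw [← Finset.sum_mul, h]
  split_ifs <;> simp

theorem sum_norm_sq_le_of_orthogonal {M Y : Type*} [Fintype M] [Fintype Y] (k : M → Y → ℂ) {D : ℝ}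
    (hD : 0 ≤ D) (P : Y → Y → Prop) [DecidableRel P]
    (h : ∀ y y', ∑ m, k m y * conj (k m y') = if P y y' then (D : ℂ) else 0) (w : Y → ℂ) :
    ∑ m, ‖∑ y, k m y * w y‖ ^ 2 ≤ D * ∑ y, ∑ y', if P y y' then ‖w y‖ * ‖w y'‖ else 0 := by
  have h0 : (0 : ℝ) ≤ ∑ m, ‖∑ y, k m y * w y‖ ^ 2 := Finset.sum_nonneg fun _ _ => by positivity
  have h1 := congrArg norm (sum_norm_sq_eq_of_orthogonal k D P h w)
  rw [Complex.norm_of_nonneg h0, norm_mul, Complex.norm_of_nonneg hD] at h1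
  rw [h1]
  refine mul_le_mul_of_nonneg_left ?_ hD
  refine (norm_sum_le _ _).trans (Finset.sum_le_sum fun y _ => ?_)
  refine (norm_sum_le _ _).trans (Finset.sum_le_sum fun y' _ => ?_)
  split_ifs <;> simp

theorem sum_norm_sq_of_orthogonal {M Y : Type*} [Fintype M] [Fintype Y] [DecidableEq Y]
    (k : M → Y → ℂ) (D : ℝ)
    (h : ∀ y y', ∑ m, k m y * conj (k m y') = if y = y' then (D : ℂ) else 0) (w : Y → ℂ) :
    ∑ m, ‖∑ y, k m y * w y‖ ^ 2 = D * ∑ y, ‖w y‖ ^ 2 := by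
  have h1 := sum_norm_sq_eq_of_orthogonal k D (· = ·) h w
  have h2 : ∀ y, w y * conj (w y) = ((‖w y‖ ^ 2 : ℝ) : ℂ) := fun y => by
    rw [Complex.mul_conj', Complex.ofReal_pow]
  simp only [Finset.sum_ite_eq, Finset.mem_univ, if_true, h2] at h1
  exact_mod_cast h1

section
variable {F : Type*} [Field F] [Fintype F] {χ : AddChar F ℂ}

theorem sum_addChar_mul [DecidableEq F] (hχ : χ ≠ 1) (b : F) :
    ∑ t, χ (t * b) = if b = 0 then (Fintype.card F : ℂ) else 0 := by
  rw [AddChar.sum_mulShift b (AddChar.IsPrimitive.of_ne_one hχ)]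
  split_ifs <;> simp

theorem sum_addChar_dotProduct {ι : Type*} [Fintype ι] [DecidableEq ι] [DecidableEq F]
    (hχ : χ ≠ 1) (z : ι → F) :
    ∑ m : ι → F, χ (m ⬝ᵥ z)
      = if z = 0 then ((Fintype.card F : ℂ) ^ Fintype.card ι) else 0 := by
  have h1 : ∀ m : ι → F, χ (m ⬝ᵥ z) = ∏ i, χ (m i * z i) := fun m =>
    map_prod χ.toMonoidHom (fun i => Multiplicative.ofAdd (m i * z i)) Finset.univ
  simp only [h1]
  rw [← Fintype.prod_sum (fun i (t : F) => χ (t * z i))]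
  simp only [sum_addChar_mul hχ]
  split_ifs with hz
  · simp [hz]
  · obtain ⟨i, hi⟩ := Function.ne_iff.mp hz
    exact Finset.prod_eq_zero (Finset.mem_univ i) (if_neg hi)

theorem addChar_mul_conj (a b : F) : χ a * conj (χ b) = χ (a - b) := by
  rw [← AddChar.map_neg_eq_conj, ← AddChar.map_add_eq_mul, sub_eq_add_neg]

/-- Orthogonality of the characters `m ↦ χ (m ⬝ᵥ φ y)`. -/
theorem sum_addChar_dotProduct_mul_conj {ι Y : Type*} [Fintype ι] [DecidableEq ι] [DecidableEq F]
    (hχ : χ ≠ 1) (φ : Y → ι → F) (y y' : Y) :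
    ∑ m : ι → F, χ (m ⬝ᵥ φ y) * conj (χ (m ⬝ᵥ φ y'))
      = if φ y = φ y' then ((((Fintype.card F : ℝ) ^ Fintype.card ι : ℝ)) : ℂ) else 0 := by
  simp only [addChar_mul_conj, ← dotProduct_sub, sum_addChar_dotProduct hχ, sub_eq_zero]
  push_cast
  rfl

/-- Plancherel's inequality when the frequencies `φ y` may coincide. -/
theorem plancherel_le {ι Y : Type*} [Fintype ι] [DecidableEq ι] [DecidableEq F] [Fintype Y]
    (hχ : χ ≠ 1) (φ : Y → ι → F) (w : Y → ℂ) :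
    ∑ m : ι → F, ‖∑ y, χ (m ⬝ᵥ φ y) * w y‖ ^ 2
      ≤ (Fintype.card F : ℝ) ^ Fintype.card ι
        * ∑ y, ∑ y', if φ y = φ y' then ‖w y‖ * ‖w y'‖ else 0 :=
  sum_norm_sq_le_of_orthogonal (fun m y => χ (m ⬝ᵥ φ y)) (by positivity) (fun y y' => φ y = φ y')
    (sum_addChar_dotProduct_mul_conj hχ φ) w

theorem plancherel {ι Y : Type*} [Fintype ι] [DecidableEq ι] [Fintype Y]
    (hχ : χ ≠ 1) {φ : Y → ι → F} (hφ : Function.Injective φ) (w : Y → ℂ) :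
    ∑ m : ι → F, ‖∑ y, χ (m ⬝ᵥ φ y) * w y‖ ^ 2
      = (Fintype.card F : ℝ) ^ Fintype.card ι * ∑ y, ‖w y‖ ^ 2 := by
  classical
  refine sum_norm_sq_of_orthogonal (fun m y => χ (m ⬝ᵥ φ y)) _ (fun y y' => ?_) w
  rw [sum_addChar_dotProduct_mul_conj hχ φ]
  simp only [hφ.eq_iff]

/-- Plancherel's identity on the field itself. -/
theorem plancherel_one {Y : Type*} [Fintype Y] (hχ : χ ≠ 1) {φ : Y → F}
    (hφ : Function.Injective φ) (w : Y → ℂ) :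
    ∑ s : F, ‖∑ b, χ (s * φ b) * w b‖ ^ 2 = (Fintype.card F : ℝ) * ∑ b, ‖w b‖ ^ 2 := by
  classical
  refine sum_norm_sq_of_orthogonal (fun s b => χ (s * φ b)) _ (fun y y' => ?_) w
  simp only [addChar_mul_conj, ← mul_sub, sum_addChar_mul hχ, sub_eq_zero, hφ.eq_iff]
  push_cast
  rfl

end

/-! ### Quadratic forms and Gauss sums -/

section
variable {F : Type*} [Field F] {d : ℕ}

theorem quadForm_eq (A : Matrix (Fin d) (Fin d) F) (x : Fin d → F) :
    quadForm A x = x ⬝ᵥ A *ᵥ x := by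
  simp only [quadForm, dotProduct, Matrix.mulVec, Finset.mul_sum]
  exact Finset.sum_congr rfl fun i _ => Finset.sum_congr rfl fun k _ => by ring

theorem dotProduct_mulVec_comm {A : Matrix (Fin d) (Fin d) F} (hA : A.IsSymm) (x y : Fin d → F) :
    x ⬝ᵥ A *ᵥ y = y ⬝ᵥ A *ᵥ x := by
  rw [Matrix.dotProduct_mulVec, ← Matrix.mulVec_transpose, hA.eq, dotProduct_comm]

theorem quadForm_add {A : Matrix (Fin d) (Fin d) F} (hA : A.IsSymm) (x y : Fin d → F) :
    quadForm A (x + y) = quadForm A x + 2 * (x ⬝ᵥ A *ᵥ y) + quadForm A y := by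
  simp only [quadForm_eq, Matrix.mulVec_add, dotProduct_add, add_dotProduct,
    dotProduct_mulVec_comm hA y x]
  ring

theorem quadForm_smul (A : Matrix (Fin d) (Fin d) F) (c : F) (x : Fin d → F) :
    quadForm A (c • x) = c ^ 2 * quadForm A x := by
  simp only [quadForm_eq, Matrix.mulVec_smul, dotProduct_smul, smul_dotProduct, smul_eq_mul]
  ring

theorem quadForm_sub {A : Matrix (Fin d) (Fin d) F} (hA : A.IsSymm) (x y : Fin d → F) :
    quadForm A (x - y) = quadForm A x - 2 * (x ⬝ᵥ A *ᵥ y) + quadForm A y := by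
  have h := quadForm_add hA x ((-1 : F) • y)
  rw [quadForm_smul, Matrix.mulVec_smul, dotProduct_smul, smul_eq_mul, neg_one_smul,
    ← sub_eq_add_neg] at h
  rw [h]
  ring

end

section
variable {F : Type*} [Field F] [Fintype F] {d : ℕ} {χ : AddChar F ℂ}

/-- The convolution operator with kernel `m ↦ χ (s Q(m))`, `s ≠ 0`, is `q ^ (d / 2)` times a
unitary operator: up to unimodular factors it is a Fourier transform. -/
theorem sum_norm_sq_quadratic_conv (hF : ringChar F ≠ 2) (hχ : χ ≠ 1)
    {A : Matrix (Fin d) (Fin d) F} (hA : A.IsSymm) (hA' : IsUnit A) {s : F} (hs : s ≠ 0)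
    (w : (Fin d → F) → ℂ) :
    ∑ m, ‖∑ m', χ (s * quadForm A (m - m')) * w m'‖ ^ 2
      = (Fintype.card F : ℝ) ^ d * ∑ m, ‖w m‖ ^ 2 := by
  have hinj : Function.Injective fun m' : Fin d → F => (-(2 * s)) • A *ᵥ m' := by
    intro x y hxy
    have h2 : (-(2 * s)) ≠ 0 := neg_ne_zero.mpr (mul_ne_zero (Ring.two_ne_zero hF) hs)
    exact Matrix.mulVec_injective_iff_isUnit.mpr hA' (smul_right_injective _ h2 hxy)
  have h := plancherel hχ hinj fun m' => χ (s * quadForm A m') * w m'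
  have h1 : ∀ m, ‖w m‖ ^ 2 = ‖χ (s * quadForm A m) * w m‖ ^ 2 := fun m => by
    rw [norm_mul, AddChar.norm_apply, one_mul]
  rw [Fintype.card_fin] at h
  rw [Finset.sum_congr rfl fun m _ => h1 m, ← h]
  refine Finset.sum_congr rfl fun m _ => ?_
  have h3 : ∑ m', χ (s * quadForm A (m - m')) * w m'
      = χ (s * quadForm A m)
        * ∑ m', χ (m ⬝ᵥ (-(2 * s)) • A *ᵥ m') * (χ (s * quadForm A m') * w m') := by
    rw [Finset.mul_sum]
    refine Finset.sum_congr rfl fun m' _ => ?_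
    rw [← mul_assoc, ← mul_assoc, ← AddChar.map_add_eq_mul, ← AddChar.map_add_eq_mul,
      quadForm_sub hA, dotProduct_smul, smul_eq_mul]
    congr 2
    ring
  rw [h3, norm_mul, AddChar.norm_apply, one_mul]

theorem norm_sq_sum_quadratic_le (hF : ringChar F ≠ 2) (hχ : χ ≠ 1)
    {A : Matrix (Fin d) (Fin d) F} (hA : A.IsSymm) (hA' : IsUnit A) {s : F} (hs : s ≠ 0)
    (v w : (Fin d → F) → ℂ) :
    ‖∑ m, ∑ m', χ (s * quadForm A (m - m')) * (v m * w m')‖ ^ 2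
      ≤ (Fintype.card F : ℝ) ^ d * (∑ m, ‖v m‖ ^ 2) * ∑ m, ‖w m‖ ^ 2 := by
  have h1 : ‖∑ m, ∑ m', χ (s * quadForm A (m - m')) * (v m * w m')‖
      ≤ ∑ m, ‖v m‖ * ‖∑ m', χ (s * quadForm A (m - m')) * w m'‖ := by
    refine (norm_sum_le _ _).trans (Finset.sum_le_sum fun m _ => ?_)
    rw [← norm_mul, Finset.mul_sum]
    exact le_of_eq (congrArg _ (Finset.sum_congr rfl fun _ _ => by ring))
  calc _ ≤ (∑ m, ‖v m‖ * ‖∑ m', χ (s * quadForm A (m - m')) * w m'‖) ^ 2 :=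
        pow_le_pow_left₀ (norm_nonneg _) h1 2
    _ ≤ (∑ m, ‖v m‖ ^ 2) * ∑ m, ‖∑ m', χ (s * quadForm A (m - m')) * w m'‖ ^ 2 :=
        Finset.sum_mul_sq_le_sq_mul_sq _ _ _
    _ = _ := by rw [sum_norm_sq_quadratic_conv hF hχ hA hA' hs]; ring

/-- The Gauss sum `∑ x, χ (t Q(x))` of the quadratic form `Q`, set to `0` for `t = 0`. -/
noncomputable def gaussWeight (χ : AddChar F ℂ) (A : Matrix (Fin d) (Fin d) F) (t : F) : ℂ :=
  open Classical in if t = 0 then 0 else ∑ x, χ (t * quadForm A x)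

theorem gaussWeight_zero (A : Matrix (Fin d) (Fin d) F) : gaussWeight χ A 0 = 0 := if_pos rfl

theorem gaussWeight_of_ne (A : Matrix (Fin d) (Fin d) F) {t : F} (ht : t ≠ 0) :
    gaussWeight χ A t = ∑ x, χ (t * quadForm A x) := if_neg ht

theorem norm_gaussWeight_sq (hF : ringChar F ≠ 2) (hχ : χ ≠ 1)
    {A : Matrix (Fin d) (Fin d) F} (hA : A.IsSymm) (hA' : IsUnit A) {t : F} (ht : t ≠ 0) :
    ‖gaussWeight χ A t‖ ^ 2 = (Fintype.card F : ℝ) ^ d := by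
  -- Every translate of the sum has the same value.
  have h := sum_norm_sq_quadratic_conv hF hχ hA hA' ht fun _ => 1
  have h1 : ∀ m : Fin d → F, ∑ m', χ (t * quadForm A (m - m')) = gaussWeight χ A t :=
    fun m => by
      rw [gaussWeight_of_ne A ht, ← (Equiv.subLeft m).sum_comp fun x => χ (t * quadForm A x)]
      simp
  simp only [mul_one, h1, norm_one, one_pow, Finset.sum_const, Finset.card_univ, nsmul_eq_mul,
    Fintype.card_pi_const] at h
  rw [mul_comm] at h
  push_cast at h
  have hq : (0 : ℝ) < (Fintype.card F : ℝ) ^ d := by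
    have := Fintype.card_pos (α := F); positivity
  exact mul_right_cancel₀ hq.ne' h

theorem norm_gaussWeight_sq_le (hF : ringChar F ≠ 2) (hχ : χ ≠ 1)
    {A : Matrix (Fin d) (Fin d) F} (hA : A.IsSymm) (hA' : IsUnit A) (t : F) :
    ‖gaussWeight χ A t‖ ^ 2 ≤ (Fintype.card F : ℝ) ^ d := by
  rcases eq_or_ne t 0 with rfl | ht
  · rw [gaussWeight_zero]; simp
  · exact (norm_gaussWeight_sq hF hχ hA hA' ht).le

theorem gaussWeight_mul_sq (A : Matrix (Fin d) (Fin d) F) {c : F} (hc : c ≠ 0) (t : F) :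
    gaussWeight χ A (c ^ 2 * t) = gaussWeight χ A t := by
  rcases eq_or_ne t 0 with rfl | ht
  · rw [mul_zero]
  · rw [gaussWeight_of_ne A ht, gaussWeight_of_ne A (mul_ne_zero (pow_ne_zero 2 hc) ht)]
    rw [← (Equiv.smulRight hc : (Fin d → F) ≃ _).sum_comp fun x => χ (t * quadForm A x)]
    refine Finset.sum_congr rfl fun x _ => ?_
    rw [Equiv.smulRight_apply, quadForm_smul]
    congr 1; ring

end

/-! ### Averages over dilations by squares -/

section
variable {F : Type*} [Field F] [Fintype F] {d : ℕ} {χ : AddChar F ℂ}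

theorem three_le_card (hF : ringChar F ≠ 2) : 3 ≤ Fintype.card F := by
  have h1 : 1 < Fintype.card F := Fintype.one_lt_card
  have h2 : Fintype.card F ≠ 2 := fun h =>
    hF (FiniteField.even_card_iff_char_two.mpr (by rw [h]))
  omega

/-- A nonnegative function that is invariant along the orbit `c ^ 2 * j` of `j ≠ 0` is at most
about twice its average over the field, because every point is hit by at most two `c`. -/
theorem card_sub_one_mul_le_of_sq_invariant {Φ : F → ℝ} (hΦ : ∀ b, 0 ≤ Φ b) {j : F} (hj : j ≠ 0)
    (hinv : ∀ c, c ≠ 0 → Φ (c ^ 2 * j) = Φ j) :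
    ((Fintype.card F : ℝ) - 1) * Φ j ≤ 2 * ∑ b, Φ b := by
  classical
  have h1 : ((Fintype.card F : ℝ) - 1) * Φ j = ∑ c ∈ Finset.univ.erase (0 : F), Φ (c ^ 2 * j) := by
    rw [Finset.sum_congr rfl fun c hc => hinv c (Finset.ne_of_mem_erase hc), Finset.sum_const,
      Finset.card_erase_of_mem (Finset.mem_univ _), Finset.card_univ, nsmul_eq_mul,
      Nat.cast_sub Fintype.card_pos, Nat.cast_one]
  have h2 : ∑ c ∈ Finset.univ.erase (0 : F), Φ (c ^ 2 * j) ≤ ∑ c, Φ (c ^ 2 * j) :=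
    Finset.sum_le_univ_sum_of_nonneg fun c => hΦ _
  rw [h1]
  refine h2.trans ?_
  rw [← Finset.sum_fiberwise Finset.univ fun c : F => c ^ 2 * j, Finset.mul_sum]
  refine Finset.sum_le_sum fun b _ => ?_
  rw [Finset.sum_congr rfl fun c hc => congrArg Φ (Finset.mem_filter.mp hc).2, Finset.sum_const,
    nsmul_eq_mul]
  refine mul_le_mul_of_nonneg_right ?_ (hΦ b)
  rcases ({c ∈ Finset.univ | c ^ 2 * j = b} : Finset F).eq_empty_or_nonempty with he | ⟨c₀, hc₀⟩
  · simp [he]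
  · have hsub : ({c ∈ Finset.univ | c ^ 2 * j = b} : Finset F) ⊆ {c₀, -c₀} := by
      intro c hc
      have h3 := (Finset.mem_filter.mp hc).2
      rw [← (Finset.mem_filter.mp hc₀).2] at h3
      simpa using sq_eq_sq_iff_eq_or_eq_neg.mp (mul_right_cancel₀ hj h3)
    exact_mod_cast (Finset.card_le_card hsub).trans Finset.card_le_two

/-! ### Generalized Kloosterman sums and the Fourier transform of the surface -/

/-- The Kloosterman sum `∑ t ≠ 0, χ (-(t j + b / t)) g(t)` weighted by the Gauss sums
`g(t) = ∑ x, χ (t Q(x))`. For even `d` it is a multiple of a Kloosterman sum, for odd `d` of a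
Salié sum. The term `t = 0` vanishes because the weight does. -/
noncomputable def kloostermanSum (χ : AddChar F ℂ) (A : Matrix (Fin d) (Fin d) F) (j b : F) : ℂ :=
  ∑ t, χ (-(t * j + t⁻¹ * b)) * gaussWeight χ A t

/-- Dilating `j` by a square only dilates `b`, since the Gauss sums depend on `t` modulo squares. -/
theorem kloostermanSum_sq_mul (A : Matrix (Fin d) (Fin d) F) {c : F} (hc : c ≠ 0) (j b : F) :
    kloostermanSum χ A (c ^ 2 * j) b = kloostermanSum χ A j (c ^ 2 * b) := by
  have hc2 : c ^ 2 ≠ 0 := pow_ne_zero 2 hc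
  unfold kloostermanSum
  rw [← Equiv.sum_comp (Equiv.mulLeft₀ (c ^ 2) hc2) fun t =>
    χ (-(t * j + t⁻¹ * (c ^ 2 * b))) * gaussWeight χ A t]
  refine Finset.sum_congr rfl fun t _ => ?_
  have he : Equiv.mulLeft₀ (c ^ 2) hc2 t = c ^ 2 * t := rfl
  rw [he, gaussWeight_mul_sq A hc, mul_inv]
  congr 3
  field_simp

/-- Completing the square: the inhomogeneous quadratic Gauss sum. -/
theorem sum_addChar_quadForm_sub {A : Matrix (Fin d) (Fin d) F} (hF : ringChar F ≠ 2)
    (hA : A.IsSymm) (hA' : IsUnit A) {t : F} (ht : t ≠ 0) (m : Fin d → F) :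
    ∑ x, χ (t * quadForm A x - x ⬝ᵥ m)
      = χ (-(t⁻¹ * (quadForm A⁻¹ m / 4))) * gaussWeight χ A t := by
  have h2 : (2 : F) ≠ 0 := Ring.two_ne_zero hF
  have h4 : (4 : F) ≠ 0 := by
    have : (4 : F) = 2 * 2 := by norm_num
    rw [this]; exact mul_ne_zero h2 h2
  have hdet : IsUnit A.det := (Matrix.isUnit_iff_isUnit_det A).mp hA'
  have hinv : A *ᵥ (A⁻¹ *ᵥ m) = m := by
    rw [Matrix.mulVec_mulVec, Matrix.mul_nonsing_inv A hdet, Matrix.one_mulVec]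
  rw [gaussWeight_of_ne A ht, Finset.mul_sum,
    ← Equiv.sum_comp (Equiv.addRight ((2 * t)⁻¹ • A⁻¹ *ᵥ m)) fun x => χ (t * quadForm A x - x ⬝ᵥ m)]
  refine Finset.sum_congr rfl fun x _ => ?_
  rw [← AddChar.map_add_eq_mul, Equiv.coe_addRight, quadForm_add hA, quadForm_smul,
    quadForm_eq A (A⁻¹ *ᵥ m), quadForm_eq A⁻¹, Matrix.mulVec_smul, hinv, dotProduct_smul,
    add_dotProduct, smul_dotProduct, smul_eq_mul, smul_eq_mul, dotProduct_comm (A⁻¹ *ᵥ m) m]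
  congr 1
  field_simp
  ring

/-- The Fourier transform of the indicator of the surface. -/
theorem card_mul_sum_quadSurface (hF : ringChar F ≠ 2) (hχ : χ ≠ 1)
    {A : Matrix (Fin d) (Fin d) F} (hA : A.IsSymm) (hA' : IsUnit A) (j : F) (m : Fin d → F) :
    open Classical in
    (Fintype.card F : ℂ) * ∑ x ∈ quadSurface A j, χ (-(x ⬝ᵥ m))
      = (if m = 0 then (Fintype.card F : ℂ) ^ d else 0)
        + kloostermanSum χ A j (quadForm A⁻¹ m / 4) := by
  classical
  have h1 : (Fintype.card F : ℂ) * ∑ x ∈ quadSurface A j, χ (-(x ⬝ᵥ m))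
      = ∑ t, ∑ x, χ (-(t * j)) * χ (t * quadForm A x - x ⬝ᵥ m) := by
    rw [Finset.sum_comm, Finset.mul_sum, quadSurface, Finset.sum_filter]
    refine Finset.sum_congr rfl fun x _ => ?_
    have h2 := sum_addChar_mul hχ (quadForm A x - j)
    rw [sub_eq_zero] at h2
    have h3 : ∀ t, χ (-(t * j)) * χ (t * quadForm A x - x ⬝ᵥ m)
        = χ (t * (quadForm A x - j)) * χ (-(x ⬝ᵥ m)) := fun t => by
      rw [← AddChar.map_add_eq_mul, ← AddChar.map_add_eq_mul]
      congr 1; ring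
    rw [Finset.sum_congr rfl fun t _ => h3 t, ← Finset.sum_mul, h2]
    split_ifs <;> simp
  rw [h1, ← Finset.add_sum_erase _ _ (Finset.mem_univ (0 : F)), kloostermanSum,
    ← Finset.add_sum_erase (a := (0 : F)) (s := Finset.univ)
      (f := fun t => χ (-(t * j + t⁻¹ * (quadForm A⁻¹ m / 4))) * gaussWeight χ A t)
      (Finset.mem_univ (0 : F)), gaussWeight_zero, mul_zero, zero_add]
  congr 1
  · have h4 := sum_addChar_dotProduct hχ (-m)
    simp only [neg_eq_zero, Fintype.card_fin, dotProduct_neg] at h4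
    simpa using h4
  · refine Finset.sum_congr rfl fun t ht => ?_
    rw [← Finset.mul_sum, sum_addChar_quadForm_sub hF hA hA' (Finset.ne_of_mem_erase ht),
      ← mul_assoc, ← AddChar.map_add_eq_mul]
    congr 2; ring

theorem sum_norm_sq_gaussWeight (hF : ringChar F ≠ 2) (hχ : χ ≠ 1)
    {A : Matrix (Fin d) (Fin d) F} (hA : A.IsSymm) (hA' : IsUnit A) :
    ∑ t, ‖gaussWeight χ A t‖ ^ 2
      = ((Fintype.card F : ℝ) - 1) * (Fintype.card F : ℝ) ^ d := by
  classical
  rw [← Finset.add_sum_erase _ _ (Finset.mem_univ (0 : F)), gaussWeight_zero,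
    Finset.sum_congr rfl fun t ht =>
      norm_gaussWeight_sq hF hχ hA hA' (Finset.ne_of_mem_erase ht), Finset.sum_const,
    Finset.card_erase_of_mem (Finset.mem_univ _), Finset.card_univ, nsmul_eq_mul,
    Nat.cast_sub Fintype.card_pos]
  simp

theorem norm_kloostermanSum_zero_sq_le (hF : ringChar F ≠ 2) (hχ : χ ≠ 1)
    {A : Matrix (Fin d) (Fin d) F} (hA : A.IsSymm) (hA' : IsUnit A) {j : F} (hj : j ≠ 0) :
    ‖kloostermanSum χ A j 0‖ ^ 2 ≤ 2 * (Fintype.card F : ℝ) ^ (d + 1) := by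
  have h1 := card_sub_one_mul_le_of_sq_invariant (Φ := fun j => ‖kloostermanSum χ A j 0‖ ^ 2)
    (fun b => by positivity) hj (fun c hc => by
      simp only [kloostermanSum_sq_mul A hc, mul_zero])
  have h2 := plancherel_one hχ (φ := fun t : F => -t) neg_injective (gaussWeight χ A)
  rw [sum_norm_sq_gaussWeight hF hχ hA hA'] at h2
  have h3 : ∀ j, kloostermanSum χ A j 0 = ∑ t, χ (j * -t) * gaussWeight χ A t := fun j =>
    Finset.sum_congr rfl fun t _ => by congr 2; ring
  simp only [← h3] at h2
  have hq : (0 : ℝ) < (Fintype.card F : ℝ) - 1 := by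
    have : (3 : ℝ) ≤ (Fintype.card F : ℝ) := by exact_mod_cast three_le_card hF
    linarith
  refine le_of_mul_le_mul_left (h1.trans_eq ?_) hq
  rw [h2]; ring

/-- The surface has at least `q ^ (d - 1) / 10` points. -/
theorem card_pow_le_mul_card_quadSurface (hF : ringChar F ≠ 2) {χ : AddChar F ℂ} (hχ : χ ≠ 1)
    {A : Matrix (Fin d) (Fin d) F} (hA : A.IsSymm) (hA' : IsUnit A) {j : F} (hj : j ≠ 0)
    (hd : 2 ≤ d) :
    (Fintype.card F : ℝ) ^ d ≤ 10 * ((Fintype.card F : ℝ) * (quadSurface A j).card) := by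
  have h1 := card_mul_sum_quadSurface hF hχ hA hA' j 0
  have hz : quadForm A⁻¹ (0 : Fin d → F) / 4 = 0 := by simp [quadForm]
  rw [hz, if_pos rfl] at h1
  simp only [dotProduct_zero, neg_zero, AddChar.map_zero_eq_one, Finset.sum_const, nsmul_eq_mul,
    mul_one] at h1
  have h2 := norm_kloostermanSum_zero_sq_le hF hχ hA hA' hj
  have hq : (3 : ℝ) ≤ (Fintype.card F : ℝ) := by exact_mod_cast three_le_card hF
  set q : ℝ := (Fintype.card F : ℝ) with hqdef
  have hK : kloostermanSum χ A j 0
      = ((q * (quadSurface A j).card - q ^ d : ℝ) : ℂ) := by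
    push_cast
    rw [hqdef, Complex.ofReal_natCast, h1]; ring
  rw [hK, Complex.norm_real, Real.norm_eq_abs, sq_abs] at h2
  have hd3 : 3 * q ^ (d + 1) ≤ q ^ d * q ^ d := by
    obtain ⟨k, rfl⟩ := Nat.exists_eq_add_of_le hd
    have h0 : 1 ≤ q ^ k := one_le_pow₀ (by linarith)
    have h5 : 0 ≤ q ^ k * q ^ 3 := by positivity
    calc 3 * q ^ (2 + k + 1) = (q ^ k * q ^ 3) * 3 := by ring
      _ ≤ (q ^ k * q ^ 3) * (q * q ^ k) := by
        refine mul_le_mul_of_nonneg_left ?_ h5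
        nlinarith
      _ = _ := by ring
  have hpos : 0 ≤ q ^ d := by positivity
  have h6 : |q * (quadSurface A j).card - q ^ d| ≤ 9 / 10 * q ^ d := by
    refine abs_le_of_sq_le_sq ?_ (by positivity)
    nlinarith
  have := (abs_le.mp h6).1
  linarith

/-- The fourth moment over both parameters. It counts pairs `(t, u)`, `(t', u')` with equal sums and
equal sums of inverses; these agree up to order unless both pairs are antidiagonal. -/
theorem sum_norm_kloostermanSum_pow_four_le_all (hF : ringChar F ≠ 2) (hχ : χ ≠ 1)
    {A : Matrix (Fin d) (Fin d) F} (hA : A.IsSymm) (hA' : IsUnit A) :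
    ∑ j, ∑ b, ‖kloostermanSum χ A j b‖ ^ 4 ≤ 3 * (Fintype.card F : ℝ) ^ (2 * d + 4) := by
  classical
  set q : ℝ := (Fintype.card F : ℝ) with hq
  set φ : F × F → Fin 2 → F := fun y => ![-(y.1 + y.2), -(y.1⁻¹ + y.2⁻¹)] with hφ
  set w : F × F → ℂ := fun y => gaussWeight χ A y.1 * gaussWeight χ A y.2 with hw
  have h1 : ∑ j, ∑ b, ‖kloostermanSum χ A j b‖ ^ 4
      = ∑ m : Fin 2 → F, ‖∑ y, χ (m ⬝ᵥ φ y) * w y‖ ^ 2 := by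
    rw [← (finTwoArrowEquiv F).symm.sum_comp, Fintype.sum_prod_type]
    refine Finset.sum_congr rfl fun j _ => Finset.sum_congr rfl fun b _ => ?_
    have h2 : ∑ y, χ (((finTwoArrowEquiv F).symm (j, b)) ⬝ᵥ φ y) * w y
        = kloostermanSum χ A j b ^ 2 := by
      rw [sq, kloostermanSum, Finset.sum_mul_sum, Fintype.sum_prod_type]
      refine Finset.sum_congr rfl fun t _ => Finset.sum_congr rfl fun u _ => ?_
      rw [mul_mul_mul_comm, ← AddChar.map_add_eq_mul]
      congr 2
      simp [hφ, dotProduct, Fin.sum_univ_two]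
      ring
    rw [h2, norm_pow, ← pow_mul]
  have hg : ∀ t, ‖gaussWeight χ A t‖ ≤ √(q ^ d) := fun t =>
    Real.le_sqrt_of_sq_le (norm_gaussWeight_sq_le hF hχ hA hA' t)
  have hwle : ∀ y, ‖w y‖ ≤ q ^ d := fun y => by
    rw [hw, norm_mul, ← Real.mul_self_sqrt (show 0 ≤ q ^ d by positivity)]
    exact mul_le_mul (hg _) (hg _) (norm_nonneg _) (Real.sqrt_nonneg _)
  have hw0 : ∀ y, w y ≠ 0 → y.1 ≠ 0 ∧ y.2 ≠ 0 := fun y hy => by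
    refine ⟨fun h => hy ?_, fun h => hy ?_⟩ <;> simp [hw, h, gaussWeight_zero]
  have hpt : ∀ y y', (if φ y = φ y' then ‖w y‖ * ‖w y'‖ else 0)
      ≤ q ^ d * q ^ d * ((if y' = y then 1 else 0) + (if y' = y.swap then 1 else 0)
        + (if y.2 = -y.1 then 1 else 0) * (if y'.2 = -y'.1 then 1 else 0)) := by
    intro y y'
    have hD : 0 ≤ q ^ d * q ^ d * ((if y' = y then 1 else 0) + (if y' = y.swap then 1 else 0)
        + (if y.2 = -y.1 then 1 else 0) * (if y'.2 = -y'.1 then 1 else 0)) := by positivity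
    by_cases h : φ y = φ y'
    swap
    · rw [if_neg h]; exact hD
    rw [if_pos h]
    by_cases hy : w y = 0
    · rw [hy, norm_zero, zero_mul]; exact hD
    by_cases hy' : w y' = 0
    · rw [hy', norm_zero, mul_zero]; exact hD
    obtain ⟨ht, hu⟩ := hw0 y hy
    obtain ⟨ht', hu'⟩ := hw0 y' hy'
    have e1 : y.1 + y.2 = y'.1 + y'.2 := neg_injective (congrFun h 0)
    have e2 : y.1⁻¹ + y.2⁻¹ = y'.1⁻¹ + y'.2⁻¹ := neg_injective (congrFun h 1)
    have hone : (1 : ℝ) ≤ ((if y' = y then 1 else 0) + (if y' = y.swap then 1 else 0)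
        + (if y.2 = -y.1 then 1 else 0) * (if y'.2 = -y'.1 then 1 else 0)) := by
      by_cases hs : y.1 + y.2 = 0
      · have e3 : y.2 = -y.1 := by linear_combination hs
        have e4 : y'.2 = -y'.1 := by linear_combination hs - e1
        rw [if_pos e3, if_pos e4]
        have : (0 : ℝ) ≤ (if y' = y then 1 else 0) + (if y' = y.swap then 1 else 0) := by
          positivity
        linarith
      · -- Both pairs have the same sum and the same product.
        have e3 : y.1 * y.2 = y'.1 * y'.2 := by
          field_simp at e2
          have e5 : (y.1 + y.2) * (y'.1 * y'.2 - y.1 * y.2) = 0 := by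
            linear_combination e2 - y.1 * y.2 * e1
          rcases mul_eq_zero.mp e5 with h0 | h0
          · exact absurd h0 hs
          · linear_combination -h0
        have e4 : (y'.1 - y.1) * (y'.1 - y.2) = 0 := by
          linear_combination e3 - y'.1 * e1
        have hnn : (0 : ℝ) ≤ (if y.2 = -y.1 then 1 else 0) * (if y'.2 = -y'.1 then 1 else 0) := by
          positivity
        rcases mul_eq_zero.mp e4 with h0 | h0
        · have : y' = y := Prod.ext (by linear_combination h0) (by linear_combination -h0 - e1)
          rw [if_pos this]
          have : (0 : ℝ) ≤ (if y' = y.swap then 1 else 0) := by positivity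
          linarith
        · have : y' = y.swap := Prod.ext (by simp; linear_combination h0)
            (by simp; linear_combination -h0 - e1)
          rw [if_pos this]
          have : (0 : ℝ) ≤ (if y' = y then 1 else 0) := by positivity
          linarith
    calc ‖w y‖ * ‖w y'‖ ≤ q ^ d * q ^ d :=
          mul_le_mul (hwle _) (hwle _) (norm_nonneg _) (by positivity)
      _ ≤ _ := le_mul_of_one_le_right (by positivity) hone
  have hanti : ∑ y : F × F, (if y.2 = -y.1 then (1 : ℝ) else 0) = q := by
    rw [Fintype.sum_prod_type]
    simp [hq]
  have hcount : ∑ y : F × F, ∑ y' : F × F,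
      (((if y' = y then 1 else 0) + (if y' = y.swap then 1 else 0)
        + (if y.2 = -y.1 then 1 else 0) * (if y'.2 = -y'.1 then 1 else 0) : ℝ)) = 3 * q ^ 2 := by
    simp only [Finset.sum_add_distrib, ← Finset.mul_sum, hanti, ← Finset.sum_mul]
    simp
    rw [← hq]
    ring
  have h3 := plancherel_le hχ φ w
  rw [h1]
  refine h3.trans ?_
  rw [Fintype.card_fin, ← hq]
  calc q ^ 2 * ∑ y, ∑ y', (if φ y = φ y' then ‖w y‖ * ‖w y'‖ else 0)
      ≤ q ^ 2 * ∑ y : F × F, ∑ y' : F × F,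
        q ^ d * q ^ d * ((if y' = y then 1 else 0) + (if y' = y.swap then 1 else 0)
        + (if y.2 = -y.1 then 1 else 0) * (if y'.2 = -y'.1 then 1 else 0)) :=
        mul_le_mul_of_nonneg_left (Finset.sum_le_sum fun y _ => Finset.sum_le_sum fun y' _ =>
          hpt y y') (by positivity)
    _ = q ^ 2 * (q ^ d * q ^ d * (3 * q ^ 2)) := by
        simp only [← Finset.mul_sum]
        rw [hcount]
    _ = _ := by ring

/-- The fourth moment of the generalized Kloosterman sums, which are of size about
`q ^ ((d + 1) / 2)` on average. -/
theorem sum_norm_kloostermanSum_pow_four_le (hF : ringChar F ≠ 2) (hχ : χ ≠ 1)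
    {A : Matrix (Fin d) (Fin d) F} (hA : A.IsSymm) (hA' : IsUnit A) {j : F} (hj : j ≠ 0) :
    ∑ b, ‖kloostermanSum χ A j b‖ ^ 4 ≤ 9 * (Fintype.card F : ℝ) ^ (2 * d + 3) := by
  have h1 := card_sub_one_mul_le_of_sq_invariant
    (Φ := fun j => ∑ b, ‖kloostermanSum χ A j b‖ ^ 4)
    (fun b => by positivity) hj (fun c hc => by
      simp only [kloostermanSum_sq_mul A hc]
      exact Equiv.sum_comp (Equiv.mulLeft₀ (c ^ 2) (pow_ne_zero 2 hc))
        fun b => ‖kloostermanSum χ A j b‖ ^ 4)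
  have h2 := sum_norm_kloostermanSum_pow_four_le_all hF hχ hA hA'
  have hq : (3 : ℝ) ≤ (Fintype.card F : ℝ) := by exact_mod_cast three_le_card hF
  set q : ℝ := (Fintype.card F : ℝ)
  set Z := ∑ b, ‖kloostermanSum χ A j b‖ ^ 4
  have hZ : 0 ≤ Z := by positivity
  have h3 : (q - 1) * Z ≤ 6 * q ^ (2 * d + 4) := by linarith
  have h4 : q * Z ≤ q * (9 * q ^ (2 * d + 3)) := by
    have : q * (9 * q ^ (2 * d + 3)) = 9 * q ^ (2 * d + 4) := by ring
    rw [this]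
    nlinarith
  exact le_of_mul_le_mul_left h4 (by linarith)

end

/-! ### Intersections of the surface with its reflections and the additive energy -/

section
variable {F : Type*} [Field F] {d : ℕ}

theorem exists_dotProduct_eq_one {w : Fin d → F} (hw : w ≠ 0) : ∃ v, w ⬝ᵥ v = 1 := by
  obtain ⟨i, hi⟩ := Function.ne_iff.mp hw
  exact ⟨Pi.single i (w i)⁻¹, by rw [dotProduct_single]; exact mul_inv_cancel₀ hi⟩

/-- If a hyperplane `ξ^⊥` is totally isotropic for a nondegenerate form, it lies in the line
through `ξ`. -/
theorem eq_smul_of_isotropic {A : Matrix (Fin d) (Fin d) F} (h2 : (2 : F) ≠ 0) (hA : A.IsSymm)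
    (hA' : IsUnit A) {ξ : Fin d → F} (hξ : ξ ≠ 0)
    (hiso : ∀ v, v ⬝ᵥ A *ᵥ ξ = 0 → quadForm A v = 0) {v : Fin d → F} (hv : v ⬝ᵥ A *ᵥ ξ = 0) :
    ∃ κ : F, v = κ • ξ := by
  have hinj := Matrix.mulVec_injective_iff_isUnit.mpr hA'
  have hw : A *ᵥ ξ ≠ 0 := fun h => hξ (hinj (by rw [h, Matrix.mulVec_zero]))
  obtain ⟨v₀, hv₀⟩ := exists_dotProduct_eq_one hw
  have hpol : ∀ u, u ⬝ᵥ A *ᵥ ξ = 0 → v ⬝ᵥ A *ᵥ u = 0 := fun u hu => by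
    have h := quadForm_add hA v u
    rw [hiso v hv, hiso u hu, hiso (v + u) (by rw [add_dotProduct, hv, hu, add_zero])] at h
    simpa [h2] using h.symm
  refine ⟨v ⬝ᵥ A *ᵥ v₀, hinj (dotProduct_eq _ _ fun y => ?_)⟩
  -- `y` minus its component along `v₀` lies in the hyperplane.
  have h := hpol (y - (y ⬝ᵥ A *ᵥ ξ) • v₀) (by
    rw [sub_dotProduct, smul_dotProduct, dotProduct_comm v₀, hv₀]; simp)
  rw [Matrix.mulVec_sub, Matrix.mulVec_smul, dotProduct_sub, dotProduct_smul, sub_eq_zero] at h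
  rw [Matrix.mulVec_smul, smul_dotProduct, dotProduct_comm, dotProduct_comm (A *ᵥ ξ),
    dotProduct_mulVec_comm hA, h, smul_eq_mul, smul_eq_mul, mul_comm]

variable [Fintype F]

theorem card_mul_card_hyperplane_le {w : Fin d → F} (hw : w ≠ 0) (c : F) :
    open Classical in
    Fintype.card F * (Finset.univ.filter fun y : Fin d → F => y ⬝ᵥ w = c).card
      ≤ Fintype.card F ^ d := by
  classical
  obtain ⟨v₀, hv₀⟩ := exists_dotProduct_eq_one hw
  rw [dotProduct_comm] at hv₀
  have h := Finset.card_le_card_of_injOn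
    (s := (Finset.univ : Finset F) ×ˢ (Finset.univ.filter fun y : Fin d → F => y ⬝ᵥ w = c))
    (t := (Finset.univ : Finset (Fin d → F))) (fun p => p.2 + p.1 • v₀)
    (fun _ _ => Finset.mem_coe.mpr (Finset.mem_univ _)) (by
      rintro ⟨s, y⟩ hy ⟨s', y'⟩ hy' heq
      simp only [Finset.coe_product, Finset.coe_univ, Set.mem_prod, Set.mem_univ, true_and,
        Finset.coe_filter, Finset.mem_univ, Set.mem_ofPred_eq] at hy hy' heq
      have h1 := congrArg (· ⬝ᵥ w) heq
      simp only [add_dotProduct, smul_dotProduct, hy, hy', hv₀, smul_eq_mul, mul_one,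
        add_right_inj] at h1
      subst h1
      rw [add_left_inj] at heq
      rw [heq])
  rw [Finset.card_product, Finset.card_univ, Finset.card_univ] at h
  simpa using h

/-- For `ξ ≠ 0` the surface `Q = j` meets its reflection in the point `ξ / 2` in a quadric of a
hyperplane, and every line of a suitable direction in that hyperplane meets this quadric in at
most two points. -/
theorem card_sq_mul_card_inter_reflection_le (hF : ringChar F ≠ 2) (hd : 2 ≤ d)
    {A : Matrix (Fin d) (Fin d) F} (hA : A.IsSymm) (hA' : IsUnit A) {j : F} (hj : j ≠ 0)
    {ξ : Fin d → F} (hξ : ξ ≠ 0) :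
    open Classical in
    Fintype.card F ^ 2 * ((quadSurface A j).filter fun x => ξ - x ∈ quadSurface A j).card
      ≤ 2 * Fintype.card F ^ d := by
  classical
  have h2 : (2 : F) ≠ 0 := Ring.two_ne_zero hF
  have hw : A *ᵥ ξ ≠ 0 := fun h => hξ
    (Matrix.mulVec_injective_iff_isUnit.mpr hA' (by rw [h, Matrix.mulVec_zero]))
  set X := (quadSurface A j).filter fun x => ξ - x ∈ quadSurface A j with hX
  have hmem : ∀ x ∈ X, quadForm A x = j ∧ x ⬝ᵥ A *ᵥ ξ = quadForm A ξ / 2 := by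
    intro x hx
    simp only [hX, quadSurface, Finset.mem_filter, Finset.mem_univ, true_and] at hx
    refine ⟨hx.1, ?_⟩
    have h := quadForm_sub hA ξ x
    rw [hx.1, hx.2, dotProduct_mulVec_comm hA ξ x] at h
    field_simp
    linear_combination h
  by_cases hiso : ∀ v, v ⬝ᵥ A *ᵥ ξ = 0 → quadForm A v = 0
  · -- `ξ` itself is isotropic, hence `X` lies in the isotropic hyperplane and is empty.
    have hcard : Fintype.card F < Fintype.card (Fin d → F) := by
      rw [Fintype.card_pi_const]
      exact lt_self_pow₀ Fintype.one_lt_card hd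
    obtain ⟨v₁, v₂, hne, heq⟩ :=
      Fintype.exists_ne_map_eq_of_card_lt (fun v : Fin d → F => v ⬝ᵥ A *ᵥ ξ) hcard
    have hv : (v₁ - v₂) ⬝ᵥ A *ᵥ ξ = 0 := by rw [sub_dotProduct, sub_eq_zero]; exact heq
    obtain ⟨κ, hκ⟩ := eq_smul_of_isotropic h2 hA hA' hξ hiso hv
    have hκ0 : κ ≠ 0 := fun h => hne (sub_eq_zero.mp (by rw [hκ, h, zero_smul]))
    have hQ : quadForm A ξ = 0 := by
      have h := hiso _ hv
      rw [hκ, quadForm_smul] at h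
      exact (mul_eq_zero.mp h).resolve_left (pow_ne_zero 2 hκ0)
    have hXe : X = ∅ := Finset.eq_empty_of_forall_notMem fun x hx => by
      obtain ⟨h3, h4⟩ := hmem x hx
      rw [hQ, zero_div] at h4
      exact hj (h3 ▸ hiso x h4)
    simp [hXe]
  · push Not at hiso
    obtain ⟨u, hu, hQu⟩ := hiso
    set H := Finset.univ.filter fun y : Fin d → F => y ⬝ᵥ A *ᵥ ξ = quadForm A ξ / 2 with hH
    have h := Finset.card_le_mul_card_image_of_maps_to (s := (Finset.univ : Finset F) ×ˢ X)
      (t := H) (f := fun p => p.2 + p.1 • u) (by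
        rintro ⟨s, x⟩ hx
        have h3 := (hmem x (Finset.mem_product.mp hx).2).2
        simp only [hH, Finset.mem_filter, Finset.mem_univ, true_and, add_dotProduct,
          smul_dotProduct, hu, smul_zero, add_zero, h3]) 2 (by
        intro y _
        set Y := ((Finset.univ : Finset F) ×ˢ X).filter fun p => p.2 + p.1 • u = y with hY
        have hroot : ∀ p ∈ Y, p.2 = y - p.1 • u ∧
            quadForm A y - 2 * (p.1 * (y ⬝ᵥ A *ᵥ u)) + p.1 ^ 2 * quadForm A u = j := by
          intro p hp
          obtain ⟨hp1, hp2⟩ := Finset.mem_filter.mp hp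
          have h4 : p.2 = y - p.1 • u := eq_sub_of_add_eq hp2
          have h5 := (hmem p.2 (Finset.mem_product.mp hp1).2).1
          rw [h4, quadForm_sub hA, quadForm_smul, Matrix.mulVec_smul, dotProduct_smul,
            smul_eq_mul] at h5
          exact ⟨h4, h5⟩
        rcases Y.eq_empty_or_nonempty with he | ⟨p₀, hp₀⟩
        · simp [he]
        -- The other root of the quadratic equation along the line.
        have hsub : Y ⊆ ({p₀.1, 2 * (y ⬝ᵥ A *ᵥ u) / quadForm A u - p₀.1} : Finset F).image
            fun s => (s, y - s • u) := by
          intro p hp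
          obtain ⟨h4, h5⟩ := hroot p hp
          obtain ⟨_, h6⟩ := hroot p₀ hp₀
          refine Finset.mem_image.mpr ⟨p.1, ?_, Prod.ext rfl h4.symm⟩
          have h7 : (p.1 - p₀.1) * ((p.1 + p₀.1) * quadForm A u - 2 * (y ⬝ᵥ A *ᵥ u)) = 0 := by
            linear_combination h5 - h6
          rw [Finset.mem_insert, Finset.mem_singleton]
          rcases mul_eq_zero.mp h7 with h8 | h8
          · exact Or.inl (sub_eq_zero.mp h8)
          · right
            field_simp
            linear_combination h8
        exact (Finset.card_le_card hsub).trans (Finset.card_image_le.trans Finset.card_le_two))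
    rw [Finset.card_product, Finset.card_univ] at h
    have h3 := card_mul_card_hyperplane_le hw (quadForm A ξ / 2)
    calc Fintype.card F ^ 2 * X.card = Fintype.card F * (Fintype.card F * X.card) := by ring
      _ ≤ Fintype.card F * (2 * H.card) := Nat.mul_le_mul_left _ h
      _ = 2 * (Fintype.card F * H.card) := by ring
      _ ≤ _ := Nat.mul_le_mul_left _ h3

end

/-- Weighted additive energy: if every nonzero `ξ` has at most `N` representations as a sum of two
elements of `S`, the energy of a weight `a ≥ 0` on `S` is at most `(1 + N) ‖a‖₂⁴`. -/
theorem sum_energy_le {V : Type*} [AddCommGroup V] [DecidableEq V] (S : Finset V) {N : ℝ}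
    (hN : 0 ≤ N)
    (hrep : ∀ ξ, ξ ≠ 0 → ((S.filter fun x => ξ - x ∈ S).card : ℝ) ≤ N) {a : S → ℝ}
    (ha : ∀ x, 0 ≤ a x) :
    ∑ y : S × S, ∑ y' : S × S,
        (if (y.1 : V) + y.2 = y'.1 + y'.2 then a y.1 * a y.2 * (a y'.1 * a y'.2) else 0)
      ≤ (1 + N) * (∑ x, a x ^ 2) ^ 2 := by
  set T := ∑ x, a x ^ 2 with hT
  have hT0 : 0 ≤ T := Finset.sum_nonneg fun _ _ => sq_nonneg _
  set w : S × S → ℝ := fun y => a y.1 * a y.2 with hw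
  have hw0 : ∀ y, 0 ≤ w y := fun y => mul_nonneg (ha _) (ha _)
  have hw2 : ∑ y, w y ^ 2 = T ^ 2 := by
    rw [sq T, hT, Finset.sum_mul_sum, Fintype.sum_prod_type]
    simp only [hw, mul_pow]
  set D : S × S → ℝ := fun y => if (y.1 : V) + y.2 = 0 then w y else 0 with hD
  have hD0 : ∀ y, 0 ≤ D y := fun y => by simp only [hD]; split_ifs <;> simp [hw0]
  set E : S × S → S × S → ℝ := fun y y' =>
    if (y.1 : V) + y.2 ≠ 0 ∧ (y'.1 : V) + y'.2 = y.1 + y.2 then w y ^ 2 else 0 with hE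
  have hE0 : ∀ y y', 0 ≤ E y y' := fun y y' => by simp only [hE]; split_ifs <;> positivity
  have hpt : ∀ y y', (if (y.1 : V) + y.2 = y'.1 + y'.2 then w y * w y' else 0)
      ≤ D y * D y' + (E y y' + E y' y) / 2 := by
    intro y y'
    by_cases h : (y.1 : V) + y.2 = y'.1 + y'.2
    · by_cases h0 : (y.1 : V) + y.2 = 0
      · have h0' : (y'.1 : V) + y'.2 = 0 := h ▸ h0
        have h3 := hE0 y y'
        have h4 := hE0 y' y
        rw [if_pos h]
        simp only [hD, if_pos h0, if_pos h0']
        linarith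
      · have h0' : (y'.1 : V) + y'.2 ≠ 0 := h ▸ h0
        have h3 : E y y' = w y ^ 2 := if_pos ⟨h0, h.symm⟩
        have h4 : E y' y = w y' ^ 2 := if_pos ⟨h0', h⟩
        rw [if_pos h, h3, h4]
        have := mul_nonneg (hD0 y) (hD0 y')
        nlinarith [sq_nonneg (w y - w y')]
    · rw [if_neg h]
      have := mul_nonneg (hD0 y) (hD0 y')
      have h3 := hE0 y y'
      have h4 := hE0 y' y
      linarith
  have hDsum : ∑ y, D y ≤ T := by
    have h1 : ∀ y, D y ≤ ((if (y.1 : V) + y.2 = 0 then a y.1 ^ 2 else 0)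
        + (if (y.1 : V) + y.2 = 0 then a y.2 ^ 2 else 0)) / 2 := by
      intro y
      simp only [hD, hw]
      split_ifs
      · nlinarith [sq_nonneg (a y.1 - a y.2)]
      · simp
    have h2 : ∀ x : S, ∑ x' : S, (if (x : V) + x' = 0 then a x ^ 2 else 0) ≤ a x ^ 2 := by
      intro x
      rw [← Finset.sum_filter, Finset.sum_const, nsmul_eq_mul]
      refine mul_le_of_le_one_left (sq_nonneg _) ?_
      have hle : (Finset.univ.filter fun x' : S => (x : V) + x' = 0).card ≤ 1 :=
        Finset.card_le_one.mpr fun b hb c hc => Subtype.ext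
          (add_left_cancel ((Finset.mem_filter.mp hb).2.trans (Finset.mem_filter.mp hc).2.symm))
      exact_mod_cast hle
    have h3 : ∑ y : S × S, (if (y.1 : V) + y.2 = 0 then a y.1 ^ 2 else 0) ≤ T := by
      rw [Fintype.sum_prod_type]
      exact Finset.sum_le_sum fun x _ => h2 x
    have h4 : ∑ y : S × S, (if (y.1 : V) + y.2 = 0 then a y.2 ^ 2 else 0) ≤ T := by
      rw [Fintype.sum_prod_type_right]
      refine Finset.sum_le_sum fun x _ => ?_
      simp only [add_comm _ (x : V)]
      exact h2 x
    refine (Finset.sum_le_sum fun y _ => h1 y).trans ?_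
    rw [← Finset.sum_div, Finset.sum_add_distrib]
    linarith
  have hEsum : ∑ y, ∑ y', E y y' ≤ N * T ^ 2 := by
    rw [← hw2, Finset.mul_sum]
    refine Finset.sum_le_sum fun y _ => ?_
    by_cases h0 : (y.1 : V) + y.2 = 0
    · have : ∀ y', E y y' = 0 := fun y' => if_neg fun h => h.1 h0
      simp only [this, Finset.sum_const_zero]
      positivity
    · have h1 : ∀ y', E y y' = if (y'.1 : V) + y'.2 = y.1 + y.2 then w y ^ 2 else 0 := fun y' => by
        simp only [hE, ne_eq, h0, not_false_eq_true, true_and]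
      simp only [h1]
      rw [← Finset.sum_filter, Finset.sum_const, nsmul_eq_mul]
      refine mul_le_mul_of_nonneg_right (le_trans ?_ (hrep _ h0)) (sq_nonneg _)
      refine Nat.cast_le.mpr (Finset.card_le_card_of_injOn (fun y' => (y'.1 : V)) ?_ ?_)
      · intro y' hy'
        have h2 := (Finset.mem_filter.mp hy').2
        refine Finset.mem_coe.mpr (Finset.mem_filter.mpr ⟨y'.1.2, ?_⟩)
        rw [← h2, add_sub_cancel_left]
        exact y'.2.2
      · intro b hb c hc hbc
        have h2 := (Finset.mem_filter.mp hb).2.trans (Finset.mem_filter.mp hc).2.symm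
        simp only at hbc
        rw [hbc] at h2
        exact Prod.ext (Subtype.ext hbc) (Subtype.ext (add_left_cancel h2))
  calc _ ≤ ∑ y, ∑ y', (D y * D y' + (E y y' + E y' y) / 2) :=
        Finset.sum_le_sum fun y _ => Finset.sum_le_sum fun y' _ => hpt y y'
    _ = (∑ y, D y) ^ 2 + ∑ y, ∑ y', E y y' := by
        simp only [Finset.sum_add_distrib, ← Finset.sum_div]
        rw [Finset.sum_comm (f := fun y y' => E y' y), sq, Finset.sum_mul_sum]
        ring
    _ ≤ T ^ 2 + N * T ^ 2 := by
        refine add_le_add (pow_le_pow_left₀ (Finset.sum_nonneg fun y _ => hD0 y) hDsum 2) hEsum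
    _ = _ := by ring

section
variable {F : Type*} [Field F] [Fintype F] {d : ℕ} {χ : AddChar F ℂ}

/-- The `L² → L⁴` estimate in terms of exponential sums. -/
theorem card_sq_mul_sum_norm_pow_four_le (hF : ringChar F ≠ 2) (hχ : χ ≠ 1) (hd : 2 ≤ d)
    {A : Matrix (Fin d) (Fin d) F} (hA : A.IsSymm) (hA' : IsUnit A) {j : F} (hj : j ≠ 0)
    (f : quadSurface A j → ℂ) :
    (Fintype.card F : ℝ) ^ 2 *
        ∑ m : Fin d → F, ‖∑ x : quadSurface A j, χ (-((x : Fin d → F) ⬝ᵥ m)) * f x‖ ^ 4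
      ≤ 3 * ((Fintype.card F : ℝ) ^ d * ∑ x, ‖f x‖ ^ 2) ^ 2 := by
  classical
  have hq : (3 : ℝ) ≤ (Fintype.card F : ℝ) := by exact_mod_cast three_le_card hF
  set q : ℝ := (Fintype.card F : ℝ) with hqdef
  have hq2 : 0 < q ^ 2 := by positivity
  have hen := sum_energy_le (quadSurface A j) (N := 2 * q ^ d / q ^ 2) (by positivity)
    (fun ξ hξ => by
      rw [le_div_iff₀ hq2, mul_comm, hqdef]
      exact_mod_cast card_sq_mul_card_inter_reflection_le hF hd hA hA' hj hξ)
    (a := fun x => ‖f x‖) (fun x => norm_nonneg _)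
  have hpl := plancherel_le hχ (fun y : quadSurface A j × quadSurface A j =>
    -((y.1 : Fin d → F) + (y.2 : Fin d → F))) (fun y => f y.1 * f y.2)
  simp only [norm_mul, neg_inj, Fintype.card_fin, ← hqdef] at hpl
  have h1 : ∀ m : Fin d → F,
      ‖∑ x : quadSurface A j, χ (-((x : Fin d → F) ⬝ᵥ m)) * f x‖ ^ 4
      = ‖∑ y : quadSurface A j × quadSurface A j,
          χ (m ⬝ᵥ -((y.1 : Fin d → F) + (y.2 : Fin d → F))) * (f y.1 * f y.2)‖ ^ 2 := by
    intro m
    rw [show (4 : ℕ) = 2 * 2 from rfl, pow_mul, ← norm_pow, sq (∑ x : quadSurface A j, _),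
      Finset.sum_mul_sum, Fintype.sum_prod_type]
    congr 2
    refine Finset.sum_congr rfl fun x _ => Finset.sum_congr rfl fun y _ => ?_
    rw [mul_mul_mul_comm, ← AddChar.map_add_eq_mul, dotProduct_neg, dotProduct_add,
      dotProduct_comm m, dotProduct_comm m, neg_add]
  simp only [h1]
  have hqd : q ^ 2 ≤ q ^ d := pow_le_pow_right₀ (by linarith) hd
  have hT : 0 ≤ (∑ x, ‖f x‖ ^ 2) ^ 2 := sq_nonneg _
  calc _ ≤ q ^ 2 * (q ^ d * ((1 + 2 * q ^ d / q ^ 2) * (∑ x, ‖f x‖ ^ 2) ^ 2)) := by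
        refine mul_le_mul_of_nonneg_left (hpl.trans ?_) hq2.le
        exact mul_le_mul_of_nonneg_left hen (by positivity)
    _ = (q ^ 2 + 2 * q ^ d) * (q ^ d * (∑ x, ‖f x‖ ^ 2) ^ 2) := by
        field_simp
    _ ≤ (q ^ d + 2 * q ^ d) * (q ^ d * (∑ x, ‖f x‖ ^ 2) ^ 2) := by
        gcongr
    _ = _ := by ring

end

/-! ### The restriction estimate for functions bounded by an indicator -/

/-- Hölder's inequality with exponents `4` and `4 / 3`, combined with
`‖ν‖_{4/3} ≤ ‖ν‖₁^{1/2} ‖ν‖₂^{1/2}`. -/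
theorem norm_sum_mul_pow_four_le {ι : Type*} [Fintype ι] (K ν : ι → ℂ) :
    ‖∑ b, K b * ν b‖ ^ 4 ≤ (∑ b, ‖ν b‖) ^ 2 * ((∑ b, ‖K b‖ ^ 4) * ∑ b, ‖ν b‖ ^ 2) := by
  have h1 : (∑ b, ‖K b‖ * ‖ν b‖) ^ 2 ≤ (∑ b, ‖ν b‖) * ∑ b, ‖K b‖ ^ 2 * ‖ν b‖ :=
    Finset.sum_sq_le_sum_mul_sum_of_sq_le_mul _ (fun _ _ => norm_nonneg _)
      (fun _ _ => by positivity) fun b _ => le_of_eq (by ring)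
  have h2 : (∑ b, ‖K b‖ ^ 2 * ‖ν b‖) ^ 2 ≤ (∑ b, ‖K b‖ ^ 4) * ∑ b, ‖ν b‖ ^ 2 :=
    Finset.sum_sq_le_sum_mul_sum_of_sq_le_mul _ (fun _ _ => by positivity)
      (fun _ _ => by positivity) fun b _ => le_of_eq (by ring)
  have h3 : ‖∑ b, K b * ν b‖ ≤ ∑ b, ‖K b‖ * ‖ν b‖ :=
    (norm_sum_le _ _).trans_eq (Finset.sum_congr rfl fun _ _ => norm_mul _ _)
  calc ‖∑ b, K b * ν b‖ ^ 4 ≤ (∑ b, ‖K b‖ * ‖ν b‖) ^ 4 :=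
        pow_le_pow_left₀ (norm_nonneg _) h3 4
    _ = ((∑ b, ‖K b‖ * ‖ν b‖) ^ 2) ^ 2 := by ring
    _ ≤ ((∑ b, ‖ν b‖) * ∑ b, ‖K b‖ ^ 2 * ‖ν b‖) ^ 2 :=
        pow_le_pow_left₀ (by positivity) h1 2
    _ = (∑ b, ‖ν b‖) ^ 2 * (∑ b, ‖K b‖ ^ 2 * ‖ν b‖) ^ 2 := by ring
    _ ≤ _ := mul_le_mul_of_nonneg_left h2 (by positivity)

section
variable {F : Type*} [Field F] [Fintype F] {d : ℕ} {χ : AddChar F ℂ}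

/-- The autocorrelation of `g` along the level sets of the form `Q / 4`. -/
noncomputable def levelCorrelation (A : Matrix (Fin d) (Fin d) F) (g : (Fin d → F) → ℂ) (b : F) :
    ℂ :=
  open Classical in ∑ m, ∑ m', if quadForm A (m - m') / 4 = b then g m * conj (g m') else 0

theorem sum_mul_levelCorrelation (A : Matrix (Fin d) (Fin d) F) (g : (Fin d → F) → ℂ)
    (K : F → ℂ) :
    ∑ b, K b * levelCorrelation A g b
      = ∑ m, ∑ m', K (quadForm A (m - m') / 4) * (g m * conj (g m')) := by
  classical
  simp only [levelCorrelation, Finset.mul_sum]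
  rw [Finset.sum_comm]
  refine Finset.sum_congr rfl fun m _ => ?_
  rw [Finset.sum_comm]
  refine Finset.sum_congr rfl fun m' _ => ?_
  simp

theorem sum_norm_levelCorrelation_le (A : Matrix (Fin d) (Fin d) F) (g : (Fin d → F) → ℂ) :
    ∑ b, ‖levelCorrelation A g b‖ ≤ (∑ m, ‖g m‖) ^ 2 := by
  classical
  have h1 : ∀ b, ‖levelCorrelation A g b‖
      ≤ ∑ m, ∑ m', if quadForm A (m - m') / 4 = b then ‖g m‖ * ‖g m'‖ else 0 := fun b => by
    refine (norm_sum_le _ _).trans (Finset.sum_le_sum fun m _ => ?_)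
    refine (norm_sum_le _ _).trans (Finset.sum_le_sum fun m' _ => ?_)
    split_ifs <;> simp
  refine (Finset.sum_le_sum fun b _ => h1 b).trans_eq ?_
  rw [Finset.sum_comm, sq, Finset.sum_mul_sum]
  refine Finset.sum_congr rfl fun m _ => ?_
  rw [Finset.sum_comm]
  refine Finset.sum_congr rfl fun m' _ => ?_
  simp

/-- By Parseval in the level, the `L²` norm of the correlation is a mean of the quadratic
convolution forms, which are small at every nonzero frequency. -/
theorem card_mul_sum_norm_sq_levelCorrelation_le (hF : ringChar F ≠ 2) (hχ : χ ≠ 1)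
    {A : Matrix (Fin d) (Fin d) F} (hA : A.IsSymm) (hA' : IsUnit A) (g : (Fin d → F) → ℂ) :
    (Fintype.card F : ℝ) * ∑ b, ‖levelCorrelation A g b‖ ^ 2
      ≤ (∑ m, ‖g m‖) ^ 4 + (Fintype.card F : ℝ) ^ (d + 1) * (∑ m, ‖g m‖ ^ 2) ^ 2 := by
  classical
  have h4 : (4 : F) ≠ 0 := by
    have h2 : (2 : F) ≠ 0 := Ring.two_ne_zero hF
    have : (4 : F) = 2 * 2 := by norm_num
    rw [this]; exact mul_ne_zero h2 h2
  have hpl := plancherel_one hχ (φ := fun b : F => b) (fun _ _ h => h) (levelCorrelation A g)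
  simp only [fun s => sum_mul_levelCorrelation A g fun b => χ (s * b)] at hpl
  rw [← hpl, ← Finset.add_sum_erase _ _ (Finset.mem_univ (0 : F))]
  refine add_le_add ?_ ?_
  · -- The frequency zero sees only the total mass.
    have h0 : ‖∑ m, ∑ m', χ (0 * (quadForm A (m - m') / 4)) * (g m * conj (g m'))‖
        ≤ (∑ m, ‖g m‖) ^ 2 := by
      rw [sq, Finset.sum_mul_sum]
      refine (norm_sum_le _ _).trans (Finset.sum_le_sum fun m _ => ?_)
      refine (norm_sum_le _ _).trans (Finset.sum_le_sum fun m' _ => ?_)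
      simp
    calc _ ≤ ((∑ m, ‖g m‖) ^ 2) ^ 2 := pow_le_pow_left₀ (norm_nonneg _) h0 2
      _ = _ := by ring
  · have h1 : ∀ s ∈ Finset.univ.erase (0 : F),
        ‖∑ m, ∑ m', χ (s * (quadForm A (m - m') / 4)) * (g m * conj (g m'))‖ ^ 2
        ≤ (Fintype.card F : ℝ) ^ d * (∑ m, ‖g m‖ ^ 2) ^ 2 := fun s hs => by
      have h := norm_sq_sum_quadratic_le hF hχ hA hA'
        (div_ne_zero (Finset.ne_of_mem_erase hs) h4) g fun m => conj (g m)
      simp only [RCLike.norm_conj] at h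
      rw [mul_assoc, ← sq] at h
      simpa only [div_mul_eq_mul_div, mul_div_assoc'] using h
    refine (Finset.sum_le_sum h1).trans ?_
    rw [Finset.sum_const, nsmul_eq_mul, pow_succ' _ d, mul_assoc]
    refine mul_le_mul_of_nonneg_right ?_ (by positivity)
    exact_mod_cast Finset.card_le_univ _

/-- The `L²` norm on the surface of a Fourier transform, as a diagonal term plus a pairing of the
generalized Kloosterman sums with the autocorrelation along the level sets of the dual form. -/
theorem card_mul_sum_norm_sq_eq (hF : ringChar F ≠ 2) (hχ : χ ≠ 1)
    {A : Matrix (Fin d) (Fin d) F} (hA : A.IsSymm) (hA' : IsUnit A) (j : F)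
    (g : (Fin d → F) → ℂ) :
    (((Fintype.card F : ℝ) * ∑ x ∈ quadSurface A j, ‖∑ m, χ (-(x ⬝ᵥ m)) * g m‖ ^ 2 : ℝ) : ℂ)
      = (((Fintype.card F : ℝ) ^ d * ∑ m, ‖g m‖ ^ 2 : ℝ) : ℂ)
        + ∑ b, kloostermanSum χ A j b * levelCorrelation A⁻¹ g b := by
  classical
  have h1 : ∀ x : Fin d → F, ((‖∑ m, χ (-(x ⬝ᵥ m)) * g m‖ ^ 2 : ℝ) : ℂ)
      = ∑ m, ∑ m', χ (-(x ⬝ᵥ (m - m'))) * (g m * conj (g m')) := by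
    intro x
    rw [Complex.ofReal_pow, ← Complex.mul_conj', map_sum, Finset.sum_mul_sum]
    refine Finset.sum_congr rfl fun m _ => Finset.sum_congr rfl fun m' _ => ?_
    rw [map_mul, mul_mul_mul_comm, addChar_mul_conj, dotProduct_sub]
    congr 2; ring
  rw [sum_mul_levelCorrelation]
  push_cast
  have h1' : ∀ x : Fin d → F, ((‖∑ m, χ (-(x ⬝ᵥ m)) * g m‖ : ℂ)) ^ 2
      = ∑ m, ∑ m', χ (-(x ⬝ᵥ (m - m'))) * (g m * conj (g m')) := fun x => by
    rw [← h1 x, Complex.ofReal_pow]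
  simp only [h1']
  rw [Finset.sum_comm, Finset.mul_sum, Finset.mul_sum, ← Finset.sum_add_distrib]
  refine Finset.sum_congr rfl fun m _ => ?_
  rw [Finset.sum_comm, Finset.mul_sum]
  have h2 : ∀ m' : Fin d → F, (Fintype.card F : ℂ)
      * ∑ x ∈ quadSurface A j, χ (-(x ⬝ᵥ (m - m'))) * (g m * conj (g m'))
      = (if m = m' then (Fintype.card F : ℂ) ^ d * (g m * conj (g m')) else 0)
        + kloostermanSum χ A j (quadForm A⁻¹ (m - m') / 4) * (g m * conj (g m')) := fun m' => by
    rw [← Finset.sum_mul, ← mul_assoc, card_mul_sum_quadSurface hF hχ hA hA', add_mul, ite_mul,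
      zero_mul]
    simp only [sub_eq_zero]
  simp only [h2, Finset.sum_add_distrib, Finset.sum_ite_eq, Finset.mem_univ, if_true]
  rw [Complex.mul_conj']

/-- The `L²` norm on the surface of the Fourier transform of a function bounded by the indicator
of `E`: the trivial bound and, for `#E ≤ q ^ ((d + 1) / 2)`, a bound through the fourth moment
of the generalized Kloosterman sums. -/
theorem restriction_estimate (hF : ringChar F ≠ 2) (hχ : χ ≠ 1)
    {A : Matrix (Fin d) (Fin d) F} (hA : A.IsSymm) (hA' : IsUnit A) {j : F} (hj : j ≠ 0)
    {g : (Fin d → F) → ℂ} {E : Finset (Fin d → F)} (hg : ∀ m, ‖g m‖ ≤ 1)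
    (hgE : ∀ m, m ∉ E → g m = 0) :
    (∑ x ∈ quadSurface A j, ‖∑ m, χ (-(x ⬝ᵥ m)) * g m‖ ^ 2
        ≤ (Fintype.card F : ℝ) ^ d * E.card) ∧
    ((E.card : ℝ) ^ 2 ≤ (Fintype.card F : ℝ) ^ (d + 1) →
      ∃ W : ℝ, 0 ≤ W ∧ W ^ 4 ≤ 18 * (Fintype.card F : ℝ) ^ (3 * d + 3) * (E.card : ℝ) ^ 6 ∧
      (Fintype.card F : ℝ) * ∑ x ∈ quadSurface A j, ‖∑ m, χ (-(x ⬝ᵥ m)) * g m‖ ^ 2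
        ≤ (Fintype.card F : ℝ) ^ d * E.card + W) := by
  classical
  have hq : (3 : ℝ) ≤ (Fintype.card F : ℝ) := by exact_mod_cast three_le_card hF
  have hsum : ∀ k : ℕ, k ≠ 0 → ∑ m, ‖g m‖ ^ k ≤ E.card := fun k hk => by
    rw [← Finset.sum_subset (Finset.subset_univ E)
      fun m _ hm => by rw [hgE m hm, norm_zero, zero_pow hk]]
    calc _ ≤ ∑ m ∈ E, (1 : ℝ) :=
          Finset.sum_le_sum fun m _ => pow_le_one₀ (norm_nonneg _) (hg m)
      _ = _ := by simp
  have hs1 : ∑ m, ‖g m‖ ≤ E.card := by simpa using hsum 1 one_ne_zero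
  have hs2 := hsum 2 two_ne_zero
  refine ⟨?_, fun hE => ?_⟩
  · have hpl := plancherel hχ (φ := fun m : Fin d → F => -m) neg_injective g
    simp only [dotProduct_neg, Fintype.card_fin] at hpl
    calc _ ≤ ∑ x, ‖∑ m, χ (-(x ⬝ᵥ m)) * g m‖ ^ 2 :=
          Finset.sum_le_univ_sum_of_nonneg fun _ => by positivity
      _ = _ := hpl
      _ ≤ _ := mul_le_mul_of_nonneg_left hs2 (by positivity)
  · refine ⟨‖∑ b, kloostermanSum χ A j b * levelCorrelation A⁻¹ g b‖, norm_nonneg _, ?_, ?_⟩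
    · have hAi : A⁻¹.IsSymm := by
        rw [Matrix.IsSymm, Matrix.transpose_nonsing_inv, hA.eq]
      have hAi' : IsUnit A⁻¹ := by rwa [Matrix.isUnit_nonsing_inv_iff]
      have h1 := norm_sum_mul_pow_four_le (kloostermanSum χ A j) (levelCorrelation A⁻¹ g)
      have h2 := sum_norm_kloostermanSum_pow_four_le hF hχ hA hA' hj
      have h3 := sum_norm_levelCorrelation_le A⁻¹ g
      have h4 := card_mul_sum_norm_sq_levelCorrelation_le hF hχ hAi hAi' g
      set q : ℝ := (Fintype.card F : ℝ)
      set n : ℝ := (E.card : ℝ)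
      set ν2 := ∑ b, ‖levelCorrelation A⁻¹ g b‖ ^ 2
      have hn : 0 ≤ n := by positivity
      have h5 : (∑ b, ‖levelCorrelation A⁻¹ g b‖) ^ 2 ≤ n ^ 4 := by
        calc _ ≤ ((∑ m, ‖g m‖) ^ 2) ^ 2 := pow_le_pow_left₀ (by positivity) h3 2
          _ ≤ (n ^ 2) ^ 2 := by gcongr
          _ = _ := by ring
      have h6 : q * ν2 ≤ 2 * q ^ (d + 1) * n ^ 2 := by
        calc q * ν2 ≤ n ^ 4 + q ^ (d + 1) * n ^ 2 := h4.trans (by gcongr)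
          _ = n ^ 2 * n ^ 2 + q ^ (d + 1) * n ^ 2 := by ring
          _ ≤ q ^ (d + 1) * n ^ 2 + q ^ (d + 1) * n ^ 2 := by gcongr
          _ = _ := by ring
      have h7 : ν2 ≤ 2 * q ^ d * n ^ 2 := by
        refine le_of_mul_le_mul_left (h6.trans_eq ?_) (by linarith : 0 < q)
        ring
      calc _ ≤ n ^ 4 * ((9 * q ^ (2 * d + 3)) * (2 * q ^ d * n ^ 2)) := h1.trans (by gcongr)
        _ = _ := by ring
    · have h := card_mul_sum_norm_sq_eq hF hχ hA hA' j g
      have h1 := congrArg norm h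
      rw [Complex.norm_of_nonneg (by positivity)] at h1
      rw [h1]
      refine (norm_add_le _ _).trans (add_le_add ?_ le_rfl)
      rw [Complex.norm_of_nonneg (by positivity)]
      exact mul_le_mul_of_nonneg_left hs2 (by positivity)

end

/-! ### From level sets to power sums -/

/-- If every nonempty set `E` contains a point where `a ≤ ψ (#E)`, the decreasing rearrangement of
`a` is bounded by `ψ`. -/
theorem sum_le_sum_range_of_exists_le {X : Type*} [DecidableEq X] {a : X → ℝ} {ψ : ℕ → ℝ}
    (h : ∀ E : Finset X, E.Nonempty → ∃ m ∈ E, a m ≤ ψ E.card) (E : Finset X) :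
    ∑ m ∈ E, a m ≤ ∑ n ∈ Finset.range E.card, ψ (n + 1) := by
  induction hn : E.card generalizing E with
  | zero => simp [Finset.card_eq_zero.mp hn]
  | succ n ih =>
    obtain ⟨m, hm, hle⟩ := h E (Finset.card_pos.mp (by omega))
    rw [← Finset.add_sum_erase E a hm, Finset.sum_range_succ, add_comm, ← hn]
    exact add_le_add (ih (E.erase m) (by rw [Finset.card_erase_of_mem hm]; omega)) hle

/-- Comparison of `n ^ (u - 1)` with the increments of `n ^ u`, from Bernoulli's inequality. -/
theorem mul_rpow_sub_one_le_sub_of_pos {u : ℝ} (hu : 0 < u) (hu1 : u ≤ 1) (n : ℕ) :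
    u * ((n : ℝ) + 1) ^ (u - 1) ≤ ((n : ℝ) + 1) ^ u - (n : ℝ) ^ u := by
  have hn : (0 : ℝ) < (n : ℝ) + 1 := by positivity
  have hx : 0 ≤ (n : ℝ) / (n + 1) := by positivity
  have h := rpow_one_add_le_one_add_mul_self (s := (n : ℝ) / (n + 1) - 1) (by linarith)
    hu.le hu1
  rw [add_sub_cancel, Real.div_rpow (by positivity) hn.le, div_le_iff₀ (by positivity)] at h
  rw [Real.rpow_sub_one hn.ne']
  have h2 : (1 + u * ((n : ℝ) / (n + 1) - 1)) * ((n : ℝ) + 1) ^ u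
      = ((n : ℝ) + 1) ^ u - u * (((n : ℝ) + 1) ^ u / (n + 1)) := by
    field_simp; ring
  linarith

theorem mul_rpow_neg_le_sub_of_one_lt {s : ℝ} (hs : 1 < s) {n : ℕ} (hn0 : 0 < n) :
    (s - 1) * ((n : ℝ) + 1) ^ (-s) ≤ (n : ℝ) ^ (1 - s) - ((n : ℝ) + 1) ^ (1 - s) := by
  have hn : (0 : ℝ) < (n : ℝ) + 1 := by positivity
  have hn' : (0 : ℝ) < (n : ℝ) := by exact_mod_cast hn0
  have hx : 0 < (n : ℝ) / (n + 1) := by positivity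
  have h : 1 + (1 - s) * ((n : ℝ) / (n + 1) - 1) ≤ ((n : ℝ) / (n + 1)) ^ (1 - s) := by
    rw [Real.rpow_def_of_pos hx]
    have h1 := Real.add_one_le_exp (Real.log ((n : ℝ) / (n + 1)) * (1 - s))
    have h2 := Real.log_le_sub_one_of_pos hx
    nlinarith
  rw [Real.div_rpow hn'.le hn.le, le_div_iff₀ (by positivity)] at h
  rw [show -s = (1 - s) - 1 by ring, Real.rpow_sub_one hn.ne']
  have h2 : (1 + (1 - s) * ((n : ℝ) / (n + 1) - 1)) * ((n : ℝ) + 1) ^ (1 - s)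
      = ((n : ℝ) + 1) ^ (1 - s) + (s - 1) * (((n : ℝ) + 1) ^ (1 - s) / (n + 1)) := by
    field_simp; ring
  linarith

theorem sum_range_rpow_neg_le {a : ℝ} (ha : 0 ≤ a) (ha1 : a < 1) (K : ℕ) :
    ∑ n ∈ Finset.range K, ((n : ℝ) + 1) ^ (-a) ≤ (K : ℝ) ^ (1 - a) / (1 - a) := by
  rw [le_div_iff₀ (by linarith), mul_comm, Finset.mul_sum]
  have h := Finset.sum_le_sum fun n (_ : n ∈ Finset.range K) =>
    mul_rpow_sub_one_le_sub_of_pos (u := 1 - a) (by linarith) (by linarith) n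
  have h2 := Finset.sum_range_sub (fun n : ℕ => (n : ℝ) ^ (1 - a)) K
  push_cast at h2
  rw [h2, Real.zero_rpow (by linarith), sub_zero, show 1 - a - 1 = -a by ring] at h
  exact h

theorem sum_Ico_rpow_neg_le {s : ℝ} (hs : 1 < s) {K : ℕ} (hK : 0 < K) (N : ℕ) :
    ∑ n ∈ Finset.Ico K N, ((n : ℝ) + 1) ^ (-s) ≤ (K : ℝ) ^ (1 - s) / (s - 1) := by
  rcases le_or_gt N K with hNK | hNK
  · rw [Finset.Ico_eq_empty_of_le hNK, Finset.sum_empty]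
    exact div_nonneg (by positivity) (by linarith)
  rw [le_div_iff₀ (by linarith), mul_comm, Finset.mul_sum]
  have h := Finset.sum_le_sum fun n (hn : n ∈ Finset.Ico K N) =>
    mul_rpow_neg_le_sub_of_one_lt hs (hK.trans_le (Finset.mem_Ico.mp hn).1)
  have h2 := Finset.sum_Ico_sub (fun n : ℕ => -(n : ℝ) ^ (1 - s)) hNK.le
  push_cast at h2
  simp only [neg_sub_neg] at h2
  rw [h2] at h
  refine h.trans (sub_le_self _ (by positivity))

/-- A sequence bounded by `n ^ (-ρ) + L ^ (ρ / 2 - 1) n ^ (-ρ / 2)` for `n ≤ L` and by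
`L ^ (ρ - 1) n ^ (-ρ)` for `n > L` has partial sums bounded uniformly in `L ≥ 1` when `1 < ρ < 2`:
the two powers involving `L` agree at `n = L`, and each sums to a constant on its side. -/
theorem sum_range_le_of_two_regimes {ρ : ℝ} (hρ : 1 < ρ) (hρ2 : ρ < 2) {L : ℝ} (hL : 1 ≤ L)
    {B : ℝ} (hB : 0 ≤ B) {ψ : ℕ → ℝ}
    (h1 : ∀ n : ℕ, (n : ℝ) + 1 ≤ L →
      ψ (n + 1) ≤ B * (((n : ℝ) + 1) ^ (-ρ) + L ^ (ρ / 2 - 1) * ((n : ℝ) + 1) ^ (-(ρ / 2))))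
    (h2 : ∀ n : ℕ, L < (n : ℝ) + 1 → ψ (n + 1) ≤ B * (L ^ (ρ - 1) * ((n : ℝ) + 1) ^ (-ρ)))
    (N : ℕ) :
    ∑ n ∈ Finset.range N, ψ (n + 1)
      ≤ B * (1 + 1 / (ρ - 1) + 1 / (1 - ρ / 2) + 2 ^ (ρ - 1) / (ρ - 1)) := by
  have hL0 : 0 < L := by linarith
  set K := ⌊L⌋₊ with hK
  have hK1 : 1 ≤ K := Nat.one_le_floor_iff _ |>.mpr hL
  have hKL : (K : ℝ) ≤ L := Nat.floor_le hL0.le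
  have hKL2 : L / 2 ≤ K := by
    have h3 : L < K + 1 := Nat.lt_floor_add_one L
    have h4 : (1 : ℝ) ≤ K := by exact_mod_cast hK1
    linarith
  have hK0 : (0 : ℝ) < K := by exact_mod_cast hK1
  set u : ℕ → ℝ := fun n => ((n : ℝ) + 1) ^ (-ρ)
  set v : ℕ → ℝ := fun n => if n < K then L ^ (ρ / 2 - 1) * ((n : ℝ) + 1) ^ (-(ρ / 2)) else 0
  set w : ℕ → ℝ := fun n => if n < K then 0 else L ^ (ρ - 1) * ((n : ℝ) + 1) ^ (-ρ)
  have hpt : ∀ n ∈ Finset.range N, ψ (n + 1) ≤ B * (u n + v n + w n) := by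
    intro n _
    by_cases hn : n < K
    · have h3 : (n : ℝ) + 1 ≤ L := le_trans (by exact_mod_cast hn) hKL
      simp only [u, v, w, if_pos hn, add_zero]
      exact h1 n h3
    · have h3 : L < (n : ℝ) + 1 := by
        have := (Nat.floor_lt' (a := L) (n := n + 1) (by omega)).mp (by omega)
        exact_mod_cast this
      refine (h2 n h3).trans (mul_le_mul_of_nonneg_left ?_ hB)
      simp only [u, v, w, if_neg hn, add_zero]
      have : 0 ≤ ((n : ℝ) + 1) ^ (-ρ) := by positivity
      linarith
  have hu : ∑ n ∈ Finset.range N, u n ≤ 1 + 1 / (ρ - 1) := by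
    have h3 := sum_Ico_rpow_neg_le hρ one_pos N
    rw [Nat.cast_one, Real.one_rpow] at h3
    rcases Nat.eq_zero_or_pos N with rfl | hN
    · have : 0 < ρ - 1 := by linarith
      simp only [Finset.range_zero, Finset.sum_empty]
      positivity
    · rw [Finset.range_eq_Ico, Finset.sum_eq_sum_Ico_succ_bot hN]
      refine add_le_add ?_ h3
      simp [u]
  have hv : ∑ n ∈ Finset.range N, v n ≤ 1 / (1 - ρ / 2) := by
    have h3 := sum_range_rpow_neg_le (a := ρ / 2) (by linarith) (by linarith) K
    calc ∑ n ∈ Finset.range N, v n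
        = ∑ n ∈ (Finset.range N).filter (· < K), L ^ (ρ / 2 - 1) * ((n : ℝ) + 1) ^ (-(ρ / 2)) := by
          rw [Finset.sum_filter]
      _ ≤ ∑ n ∈ Finset.range K, L ^ (ρ / 2 - 1) * ((n : ℝ) + 1) ^ (-(ρ / 2)) := by
          refine Finset.sum_le_sum_of_subset_of_nonneg (fun n hn => ?_) fun n _ _ => by positivity
          exact Finset.mem_range.mpr (Finset.mem_filter.mp hn).2
      _ ≤ L ^ (ρ / 2 - 1) * ((K : ℝ) ^ (1 - ρ / 2) / (1 - ρ / 2)) := by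
          rw [← Finset.mul_sum]
          exact mul_le_mul_of_nonneg_left h3 (by positivity)
      _ ≤ L ^ (ρ / 2 - 1) * (L ^ (1 - ρ / 2) / (1 - ρ / 2)) := by
          have h4 : 0 < 1 - ρ / 2 := by linarith
          gcongr
      _ = 1 / (1 - ρ / 2) := by
          rw [← mul_div_assoc, ← Real.rpow_add hL0]
          norm_num
  have hw : ∑ n ∈ Finset.range N, w n ≤ 2 ^ (ρ - 1) / (ρ - 1) := by
    have h3 := sum_Ico_rpow_neg_le hρ hK1 N
    have h4 : 0 < ρ - 1 := by linarith
    calc ∑ n ∈ Finset.range N, w n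
        = ∑ n ∈ (Finset.range N).filter (¬ · < K), L ^ (ρ - 1) * ((n : ℝ) + 1) ^ (-ρ) := by
          rw [Finset.sum_filter]
          refine Finset.sum_congr rfl fun n _ => ?_
          by_cases hn : n < K <;> simp [w, hn]
      _ ≤ ∑ n ∈ Finset.Ico K N, L ^ (ρ - 1) * ((n : ℝ) + 1) ^ (-ρ) := by
          refine Finset.sum_le_sum_of_subset_of_nonneg (fun n hn => ?_) fun n _ _ => by positivity
          obtain ⟨h5, h6⟩ := Finset.mem_filter.mp hn
          exact Finset.mem_Ico.mpr ⟨not_lt.mp h6, Finset.mem_range.mp h5⟩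
      _ ≤ L ^ (ρ - 1) * ((K : ℝ) ^ (1 - ρ) / (ρ - 1)) := by
          rw [← Finset.mul_sum]
          exact mul_le_mul_of_nonneg_left h3 (by positivity)
      _ ≤ L ^ (ρ - 1) * ((L / 2) ^ (1 - ρ) / (ρ - 1)) := by
          have h5 : (K : ℝ) ^ (1 - ρ) ≤ (L / 2) ^ (1 - ρ) :=
            Real.rpow_le_rpow_of_nonpos (by positivity) hKL2 (by linarith)
          gcongr
      _ = 2 ^ (ρ - 1) / (ρ - 1) := by
          rw [Real.div_rpow hL0.le (by norm_num), show 1 - ρ = -(ρ - 1) by ring,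
            Real.rpow_neg hL0.le, Real.rpow_neg (by norm_num)]
          have : L ^ (ρ - 1) ≠ 0 := by positivity
          field_simp
  calc _ ≤ ∑ n ∈ Finset.range N, B * (u n + v n + w n) := Finset.sum_le_sum hpt
    _ = B * (∑ n ∈ Finset.range N, u n + ∑ n ∈ Finset.range N, v n
          + ∑ n ∈ Finset.range N, w n) := by
        rw [← Finset.mul_sum, Finset.sum_add_distrib, Finset.sum_add_distrib]
    _ ≤ _ := mul_le_mul_of_nonneg_left (by linarith) hB

/-! ### The extension operator -/

/-- For the counting measure, an `ℓ^p` bound implies the same `ℓ^r` bound for all `r ≥ p`,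
including `r = ∞`. -/
theorem weightedLpNorm_one_le_of_sum_rpow_le {X : Type*} [Fintype X] {g : X → ℂ} {p N : ℝ}
    (hp : 0 < p) (hN : 0 ≤ N) (h : ∑ x, ‖g x‖ ^ p ≤ N ^ p) {r : ℝ≥0∞}
    (hr : ENNReal.ofReal p ≤ r) : weightedLpNorm 1 r g ≤ N := by
  have hpt : ∀ x, ‖g x‖ ≤ N := fun x => by
    refine (Real.rpow_le_rpow_iff (norm_nonneg _) hN hp).mp (le_trans ?_ h)
    exact Finset.single_le_sum (f := fun x => ‖g x‖ ^ p) (fun y _ => by positivity)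
      (Finset.mem_univ x)
  unfold weightedLpNorm
  split_ifs with hr'
  · exact Real.iSup_le hpt hN
  · have hpr : p ≤ r.toReal := (ENNReal.ofReal_le_iff_le_toReal hr').mp hr
    have hr0 : 0 < r.toReal := hp.trans_le hpr
    have h1 : ∑ x, ‖g x‖ ^ r.toReal ≤ N ^ r.toReal := by
      have h2 : ∀ x, ‖g x‖ ^ r.toReal ≤ N ^ (r.toReal - p) * ‖g x‖ ^ p := fun x => by
        calc ‖g x‖ ^ r.toReal = ‖g x‖ ^ (r.toReal - p + p) := by rw [sub_add_cancel]
          _ = ‖g x‖ ^ (r.toReal - p) * ‖g x‖ ^ p :=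
            Real.rpow_add_of_nonneg (norm_nonneg _) (by linarith) hp.le
          _ ≤ _ := mul_le_mul_of_nonneg_right
            (Real.rpow_le_rpow (norm_nonneg _) (hpt x) (by linarith)) (by positivity)
      calc _ ≤ ∑ x, N ^ (r.toReal - p) * ‖g x‖ ^ p := Finset.sum_le_sum fun x _ => h2 x
        _ = N ^ (r.toReal - p) * ∑ x, ‖g x‖ ^ p := by rw [Finset.mul_sum]
        _ ≤ N ^ (r.toReal - p) * N ^ p := mul_le_mul_of_nonneg_left h (by positivity)
        _ = N ^ (r.toReal - p + p) := (Real.rpow_add_of_nonneg hN (by linarith) hp.le).symm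
        _ = _ := by rw [sub_add_cancel]
    rw [one_mul]
    calc _ ≤ (N ^ r.toReal) ^ (1 / r.toReal) :=
          Real.rpow_le_rpow (by positivity) h1 (by positivity)
      _ = N := by rw [one_div, Real.rpow_rpow_inv hN hr0.ne']

/-- The square of the norm of `f` in `L²(S, dσ)`. -/
noncomputable def surfaceNormSq {X : Type*} {S : Finset X} (f : S → ℂ) : ℝ :=
  (S.card : ℝ)⁻¹ * ∑ x, ‖f x‖ ^ 2

theorem surfaceNormSq_nonneg {X : Type*} {S : Finset X} (f : S → ℂ) : 0 ≤ surfaceNormSq f := by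
  unfold surfaceNormSq; positivity

section
variable {F : Type*} [Field F] [Fintype F] {d : ℕ} {χ : AddChar F ℂ}

theorem extensionEstimate_of_sum_rpow_le {S : Finset (Fin d → F)} {s B : ℝ} (hs : 0 < s)
    (hB : 0 ≤ B)
    (h : ∀ f : S → ℂ, ∑ m, ‖extension χ S f m‖ ^ (2 * s) ≤ B * surfaceNormSq f ^ s)
    {r : ℝ≥0∞} (hr : ENNReal.ofReal (2 * s) ≤ r) :
    ExtensionEstimate χ S 2 r (B ^ (1 / (2 * s))).toNNReal := by
  intro f
  have hT := surfaceNormSq_nonneg f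
  have hnorm : weightedLpNorm (S.card : ℝ)⁻¹ 2 f = surfaceNormSq f ^ (1 / 2 : ℝ) := by
    rw [weightedLpNorm, if_neg (by norm_num), surfaceNormSq]
    simp
  rw [hnorm, Real.coe_toNNReal _ (by positivity)]
  refine weightedLpNorm_one_le_of_sum_rpow_le (by linarith) (by positivity) ((h f).trans_eq ?_) hr
  rw [Real.mul_rpow (by positivity) (by positivity), ← Real.rpow_mul hB, ← Real.rpow_mul hT]
  congr 1
  · rw [one_div_mul_cancel (by positivity), Real.rpow_one]
  · congr 1; ring

/-- The `L² → L⁴` estimate, valid in every dimension `d ≥ 2`. -/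
theorem sum_norm_extension_pow_four_le (hF : ringChar F ≠ 2) (hχ : χ ≠ 1) (hd : 2 ≤ d)
    {A : Matrix (Fin d) (Fin d) F} (hA : A.IsSymm) (hA' : IsUnit A) {j : F} (hj : j ≠ 0)
    (f : quadSurface A j → ℂ) :
    ∑ m, ‖extension χ (quadSurface A j) f m‖ ^ 4 ≤ 300 * surfaceNormSq f ^ 2 := by
  have h1 := card_sq_mul_sum_norm_pow_four_le hF hχ hd hA hA' hj f
  have h2 := card_pow_le_mul_card_quadSurface hF hχ hA hA' hj hd
  have hq : (3 : ℝ) ≤ (Fintype.card F : ℝ) := by exact_mod_cast three_le_card hF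
  simp only [extension, surfaceNormSq, norm_mul, norm_inv, Complex.norm_natCast, mul_pow,
    ← Finset.mul_sum]
  set q : ℝ := (Fintype.card F : ℝ)
  set c : ℝ := ((quadSurface A j).card : ℝ)
  set T := ∑ x, ‖f x‖ ^ 2
  set Z := ∑ m : Fin d → F, ‖∑ x : quadSurface A j, χ (-((x : Fin d → F) ⬝ᵥ m)) * f x‖ ^ 4
  have hT : 0 ≤ T := Finset.sum_nonneg fun _ _ => by positivity
  have hq0 : 0 < q := by linarith
  have hc : 0 < c := by
    by_contra hc
    have hc0 : 0 ≤ c := by positivity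
    have hc1 : c = 0 := by linarith
    rw [hc1] at h2
    have : 0 < q ^ d := by positivity
    linarith
  have h3 : q ^ 2 * Z ≤ q ^ 2 * (300 * c ^ 2 * T ^ 2) := by
    calc q ^ 2 * Z ≤ 3 * (q ^ d * T) ^ 2 := h1
      _ ≤ 3 * (10 * (q * c) * T) ^ 2 := by gcongr
      _ = _ := by ring
  have h4 : Z ≤ 300 * c ^ 2 * T ^ 2 := le_of_mul_le_mul_left h3 (by positivity)
  calc c⁻¹ ^ 4 * Z ≤ c⁻¹ ^ 4 * (300 * c ^ 2 * T ^ 2) := by gcongr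
    _ = 300 * (c⁻¹ ^ 2 * T ^ 2) := by field_simp

/-- Duality: the mean of the extension over `E` is controlled by the restriction to the surface of
the Fourier transform of a function bounded by the indicator of `E`. -/
theorem exists_mem_card_mul_norm_extension_le (S : Finset (Fin d → F)) (f : S → ℂ)
    {E : Finset (Fin d → F)} (hE : E.Nonempty) :
    ∃ m ∈ E, ∃ g : (Fin d → F) → ℂ, (∀ m, ‖g m‖ ≤ 1) ∧ (∀ m, m ∉ E → g m = 0) ∧
      (E.card * ‖extension χ S f m‖) ^ 2
        ≤ surfaceNormSq f * ((S.card : ℝ)⁻¹ * ∑ x ∈ S, ‖∑ m, χ (-(x ⬝ᵥ m)) * g m‖ ^ 2) := by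
  classical
  obtain ⟨T, hT⟩ : ∃ T, T = extension χ S f := ⟨_, rfl⟩
  rw [← hT]
  obtain ⟨m, hm, hmin⟩ := E.exists_min_image (fun m => ‖T m‖) hE
  set g : (Fin d → F) → ℂ := fun m => if m ∈ E then conj (T m) / ‖T m‖ else 0 with hg
  refine ⟨m, hm, g, fun m => ?_, fun m hm => if_neg hm, ?_⟩
  · simp only [hg]
    split_ifs
    · rw [norm_div, RCLike.norm_conj, Complex.norm_real, norm_norm]
      exact div_self_le_one _
    · simp
  have hgT : ∀ m ∈ E, g m * T m = (‖T m‖ : ℂ) := fun m hm => by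
    rw [hg]
    simp only [if_pos hm]
    rw [div_mul_eq_mul_div, Complex.conj_mul']
    by_cases h0 : (‖T m‖ : ℂ) = 0
    · rw [h0]; simp
    · rw [sq, mul_div_assoc, div_self h0, mul_one]
  have h1 : (E.card : ℝ) * ‖T m‖ ≤ ∑ m ∈ E, ‖T m‖ := by
    rw [← nsmul_eq_mul]
    exact Finset.card_nsmul_le_sum E _ _ hmin
  have h2 : ((∑ m ∈ E, ‖T m‖ : ℝ) : ℂ)
      = (S.card : ℂ)⁻¹ * ∑ x : S, f x * ∑ m, χ (-((x : Fin d → F) ⬝ᵥ m)) * g m := by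
    calc ((∑ m ∈ E, ‖T m‖ : ℝ) : ℂ) = ∑ m ∈ E, g m * T m := by
          push_cast
          exact (Finset.sum_congr rfl hgT).symm
      _ = ∑ m, g m * T m := by
          refine Finset.sum_subset (Finset.subset_univ E) fun m _ hm => ?_
          have h0 : g m = 0 := if_neg hm
          rw [h0, zero_mul]
      _ = _ := by
          simp only [hT, extension, Finset.mul_sum]
          rw [Finset.sum_comm]
          exact Finset.sum_congr rfl fun x _ => Finset.sum_congr rfl fun m _ => by ring
  have h3 : ∑ m ∈ E, ‖T m‖
      ≤ (S.card : ℝ)⁻¹ * ∑ x : S, ‖f x‖ * ‖∑ m, χ (-((x : Fin d → F) ⬝ᵥ m)) * g m‖ := by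
    have h4 := congrArg norm h2
    rw [Complex.norm_of_nonneg (by positivity), norm_mul, norm_inv, Complex.norm_natCast] at h4
    rw [h4]
    refine mul_le_mul_of_nonneg_left ((norm_sum_le _ _).trans_eq ?_) (by positivity)
    exact Finset.sum_congr rfl fun x _ => norm_mul _ _
  calc (E.card * ‖T m‖) ^ 2
      ≤ ((S.card : ℝ)⁻¹ * ∑ x : S, ‖f x‖ * ‖∑ m, χ (-((x : Fin d → F) ⬝ᵥ m)) * g m‖) ^ 2 :=
        pow_le_pow_left₀ (by positivity) (h1.trans h3) 2
    _ ≤ (S.card : ℝ)⁻¹ ^ 2 * ((∑ x, ‖f x‖ ^ 2)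
          * ∑ x : S, ‖∑ m, χ (-((x : Fin d → F) ⬝ᵥ m)) * g m‖ ^ 2) := by
        rw [mul_pow]
        exact mul_le_mul_of_nonneg_left (Finset.sum_mul_sq_le_sq_mul_sq _ _ _) (by positivity)
    _ = _ := by
        rw [surfaceNormSq,
          Finset.sum_coe_sort S fun x => ‖∑ m, χ (-(x ⬝ᵥ m)) * g m‖ ^ 2]
        ring

/-- The smallest value of the extension on a set `E`, in terms of the size of `E`. -/
theorem exists_mem_norm_sq_extension_le (hF : ringChar F ≠ 2) (hχ : χ ≠ 1) (hd : 2 ≤ d)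
    {A : Matrix (Fin d) (Fin d) F} (hA : A.IsSymm) (hA' : IsUnit A) {j : F} (hj : j ≠ 0)
    (f : quadSurface A j → ℂ) {E : Finset (Fin d → F)} (hE : E.Nonempty) :
    ∃ m ∈ E,
      (‖extension χ (quadSurface A j) f m‖ ^ 2
        ≤ 10 * surfaceNormSq f * ((Fintype.card F : ℝ) * (E.card : ℝ)⁻¹)) ∧
      ((E.card : ℝ) ^ 2 ≤ (Fintype.card F : ℝ) ^ (d + 1) →
        ‖extension χ (quadSurface A j) f m‖ ^ 2
          ≤ 10 * surfaceNormSq f * ((E.card : ℝ)⁻¹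
            + 3 * ((Fintype.card F : ℝ) ^ ((3 - (d : ℝ)) / 4)
              * (E.card : ℝ) ^ (-(1 / 2) : ℝ)))) := by
  obtain ⟨m, hm, g, hg, hgE, h⟩ :=
    exists_mem_card_mul_norm_extension_le (χ := χ) (quadSurface A j) f hE
  refine ⟨m, hm, ?_⟩
  obtain ⟨hV1, hV2⟩ := restriction_estimate hF hχ hA hA' hj hg hgE
  have h2 := card_pow_le_mul_card_quadSurface hF hχ hA hA' hj hd
  have hq : (3 : ℝ) ≤ (Fintype.card F : ℝ) := by exact_mod_cast three_le_card hF
  have hT := surfaceNormSq_nonneg f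
  have hn : (0 : ℝ) < E.card := by exact_mod_cast hE.card_pos
  set q : ℝ := (Fintype.card F : ℝ)
  set c : ℝ := ((quadSurface A j).card : ℝ)
  set n : ℝ := (E.card : ℝ)
  set T := surfaceNormSq f
  set V := ∑ x ∈ quadSurface A j, ‖∑ m, χ (-(x ⬝ᵥ m)) * g m‖ ^ 2
  set t := ‖extension χ (quadSurface A j) f m‖
  have hV : 0 ≤ V := Finset.sum_nonneg fun _ _ => by positivity
  have hq0 : 0 < q := by linarith
  have hqd : 0 < q ^ d := by positivity
  have hc : 0 < c := by
    by_contra hc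
    have hc0 : 0 ≤ c := by positivity
    have hc1 : c = 0 := by linarith
    rw [hc1] at h2
    linarith
  have hci : c⁻¹ ≤ 10 * q / q ^ d := by
    rw [inv_le_iff_one_le_mul₀ hc, div_mul_eq_mul_div, one_le_div hqd]
    linarith
  -- It suffices to bound `q V / q ^ d` by `n ^ 2` times the claimed factor.
  have key : ∀ Y, q * V ≤ q ^ d * (n ^ 2 * Y) → t ^ 2 ≤ 10 * T * Y := by
    intro Y hY
    have h3 : c⁻¹ * V ≤ 10 * (n ^ 2 * Y) := by
      calc c⁻¹ * V ≤ 10 * q / q ^ d * V := by gcongr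
        _ = 10 * (q * V) / q ^ d := by ring
        _ ≤ 10 * (q ^ d * (n ^ 2 * Y)) / q ^ d := by gcongr
        _ = _ := by field_simp
    have h4 : n ^ 2 * t ^ 2 ≤ n ^ 2 * (10 * T * Y) := by
      calc n ^ 2 * t ^ 2 = (n * t) ^ 2 := by ring
        _ ≤ T * (c⁻¹ * V) := h
        _ ≤ T * (10 * (n ^ 2 * Y)) := by gcongr
        _ = _ := by ring
    exact le_of_mul_le_mul_left h4 (by positivity)
  refine ⟨key _ ?_, fun hE2 => key _ ?_⟩
  · calc q * V ≤ q * (q ^ d * n) := by gcongr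
      _ = _ := by field_simp
  · obtain ⟨W, hW0, hW4, hW⟩ := hV2 hE2
    set y := q ^ ((3 - (d : ℝ)) / 4) * n ^ (-(1 / 2) : ℝ) with hy
    have hy0 : 0 ≤ y := by positivity
    have hy4 : y ^ 4 * (q ^ d * n ^ 2) = q ^ 3 := by
      have h5 : (q ^ ((3 - (d : ℝ)) / 4)) ^ 4 * q ^ d = q ^ 3 := by
        rw [← Real.rpow_natCast (q ^ ((3 - (d : ℝ)) / 4)), ← Real.rpow_mul hq0.le,
          ← Real.rpow_natCast q d, ← Real.rpow_add hq0, ← Real.rpow_natCast q 3]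
        congr 1; push_cast; ring
      have h6 : (n ^ (-(1 / 2) : ℝ)) ^ 4 * n ^ 2 = 1 := by
        rw [← Real.rpow_natCast (n ^ (-(1 / 2) : ℝ)), ← Real.rpow_mul hn.le,
          ← Real.rpow_natCast n 2, ← Real.rpow_add hn]
        norm_num
      calc y ^ 4 * (q ^ d * n ^ 2)
          = ((q ^ ((3 - (d : ℝ)) / 4)) ^ 4 * q ^ d) * ((n ^ (-(1 / 2) : ℝ)) ^ 4 * n ^ 2) := by
            rw [hy]; ring
        _ = _ := by rw [h5, h6, mul_one]
    have hWy : W ≤ q ^ d * (n ^ 2 * (3 * y)) := by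
      refine le_of_pow_le_pow_left₀ (n := 4) (by norm_num) (by positivity) (hW4.trans ?_)
      calc 18 * q ^ (3 * d + 3) * n ^ 6 ≤ 81 * q ^ (3 * d + 3) * n ^ 6 := by gcongr; norm_num
        _ = 81 * (q ^ 3 * (q ^ (3 * d) * n ^ 6)) := by ring
        _ = 81 * ((y ^ 4 * (q ^ d * n ^ 2)) * (q ^ (3 * d) * n ^ 6)) := by rw [hy4]
        _ = _ := by ring
    calc q * V ≤ q ^ d * n + W := hW
      _ ≤ q ^ d * n + q ^ d * (n ^ 2 * (3 * y)) := by gcongr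
      _ = _ := by field_simp

/-- The endpoint estimate in dimension `d ≥ 4`, where the exponent `2 (d + 1) / (d - 1)` lies
strictly between `2` and `4`. -/
theorem sum_norm_extension_rpow_le (hF : ringChar F ≠ 2) (hχ : χ ≠ 1) (hd : 4 ≤ d)
    {A : Matrix (Fin d) (Fin d) F} (hA : A.IsSymm) (hA' : IsUnit A) {j : F} (hj : j ≠ 0)
    {ρ : ℝ} (hρ : ρ = ((d : ℝ) + 1) / ((d : ℝ) - 1)) (f : quadSurface A j → ℂ) :
    ∑ m, ‖extension χ (quadSurface A j) f m‖ ^ (2 * ρ)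
      ≤ 60 ^ ρ * (1 + 1 / (ρ - 1) + 1 / (1 - ρ / 2) + 2 ^ (ρ - 1) / (ρ - 1))
        * surfaceNormSq f ^ ρ := by
  classical
  have hd4 : (4 : ℝ) ≤ d := by exact_mod_cast hd
  have hd1 : 0 < (d : ℝ) - 1 := by linarith
  have hρ1 : 1 < ρ := by rw [hρ, one_lt_div hd1]; linarith
  have hρ2 : ρ < 2 := by rw [hρ, div_lt_iff₀ hd1]; linarith
  have hq : (3 : ℝ) ≤ (Fintype.card F : ℝ) := by exact_mod_cast three_le_card hF
  have hex := fun E hE => exists_mem_norm_sq_extension_le hF hχ (by omega) hA hA' hj f (E := E) hE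
  have hT := surfaceNormSq_nonneg f
  set q : ℝ := (Fintype.card F : ℝ)
  set T := surfaceNormSq f
  have hq0 : 0 < q := by linarith
  -- The critical size of a level set, at which the two bounds agree.
  set L : ℝ := q ^ (((d : ℝ) + 1) / 2) with hLdef
  have hL1 : 1 ≤ L := Real.one_le_rpow (by linarith) (by positivity)
  have hL2 : L ^ 2 = q ^ (d + 1) := by
    rw [← Real.rpow_natCast L, hLdef, ← Real.rpow_mul hq0.le, ← Real.rpow_natCast q]
    congr 1; push_cast; ring
  have hLa : q ^ ρ = L ^ (ρ - 1) := by
    rw [hLdef, ← Real.rpow_mul hq0.le, hρ]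
    congr 1; field_simp; ring
  have hLb : (q ^ ((3 - (d : ℝ)) / 4)) ^ ρ = L ^ (ρ / 2 - 1) := by
    rw [hLdef, ← Real.rpow_mul hq0.le, ← Real.rpow_mul hq0.le, hρ]
    congr 1; field_simp; ring
  set B := (60 * T) ^ ρ with hB
  set ψ : ℕ → ℝ := fun n => if (n : ℝ) ≤ L
    then B * ((n : ℝ) ^ (-ρ) + L ^ (ρ / 2 - 1) * (n : ℝ) ^ (-(ρ / 2)))
    else B * (L ^ (ρ - 1) * (n : ℝ) ^ (-ρ)) with hψ
  have hBc : ∀ c : ℝ, 0 ≤ c → c ≤ 60 → (c * T) ^ ρ ≤ B := fun c hc hc60 =>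
    Real.rpow_le_rpow (by positivity) (mul_le_mul_of_nonneg_right hc60 hT) (by linarith)
  have hpeel := sum_le_sum_range_of_exists_le
    (a := fun m => ‖extension χ (quadSurface A j) f m‖ ^ (2 * ρ)) (ψ := ψ) (fun E hE => by
      obtain ⟨m, hm, h1, h2⟩ := hex E hE
      refine ⟨m, hm, ?_⟩
      have hn : (0 : ℝ) < E.card := by exact_mod_cast hE.card_pos
      have hsq : ‖extension χ (quadSurface A j) f m‖ ^ (2 * ρ)
          = (‖extension χ (quadSurface A j) f m‖ ^ 2) ^ ρ := by
        rw [Real.rpow_mul (norm_nonneg _)]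
        norm_num
      simp only [hψ, hsq]
      split_ifs with hEL
      · have h3 := h2 (by rw [← hL2]; exact pow_le_pow_left₀ hn.le hEL 2)
        set n : ℝ := (E.card : ℝ)
        set u := n⁻¹ with hu
        set v := q ^ ((3 - (d : ℝ)) / 4) * n ^ (-(1 / 2) : ℝ) with hv
        have hu0 : 0 ≤ u := by positivity
        have hv0 : 0 ≤ v := by positivity
        have hur : u ^ ρ = n ^ (-ρ) := by rw [hu, Real.inv_rpow hn.le, Real.rpow_neg hn.le]
        have hvr : v ^ ρ = L ^ (ρ / 2 - 1) * n ^ (-(ρ / 2)) := by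
          rw [hv, Real.mul_rpow (by positivity) (by positivity), hLb, ← Real.rpow_mul hn.le]
          congr 2; ring
        have hmax : max u v ^ ρ ≤ u ^ ρ + v ^ ρ := by
          have := Real.rpow_nonneg hu0 ρ
          have := Real.rpow_nonneg hv0 ρ
          rcases max_choice u v with h | h <;> rw [h] <;> linarith
        calc (‖extension χ (quadSurface A j) f m‖ ^ 2) ^ ρ
            ≤ (10 * T * (u + 3 * v)) ^ ρ := Real.rpow_le_rpow (by positivity) h3 (by linarith)
          _ ≤ (40 * T * max u v) ^ ρ := by
              refine Real.rpow_le_rpow (by positivity) ?_ (by linarith)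
              have := le_max_left u v
              have := le_max_right u v
              calc 10 * T * (u + 3 * v) ≤ 10 * T * (4 * max u v) :=
                    mul_le_mul_of_nonneg_left (by linarith) (by positivity)
                _ = _ := by ring
          _ = (40 * T) ^ ρ * max u v ^ ρ :=
              Real.mul_rpow (by positivity) (le_max_of_le_left hu0)
          _ ≤ B * (u ^ ρ + v ^ ρ) :=
              mul_le_mul (hBc 40 (by norm_num) (by norm_num)) hmax
                (Real.rpow_nonneg (le_max_of_le_left hu0) _) (by positivity)
          _ = _ := by rw [hur, hvr]
      · calc (‖extension χ (quadSurface A j) f m‖ ^ 2) ^ ρ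
            ≤ (10 * T * (q * (E.card : ℝ)⁻¹)) ^ ρ :=
              Real.rpow_le_rpow (by positivity) h1 (by linarith)
          _ = (10 * T) ^ ρ * (q ^ ρ * (E.card : ℝ) ^ (-ρ)) := by
              rw [Real.mul_rpow (by positivity) (by positivity),
                Real.mul_rpow hq0.le (by positivity), Real.inv_rpow hn.le, Real.rpow_neg hn.le]
          _ ≤ _ := by
              rw [hLa]
              exact mul_le_mul_of_nonneg_right (hBc 10 (by norm_num) (by norm_num))
                (by positivity)) Finset.univ
  refine hpeel.trans ((sum_range_le_of_two_regimes hρ1 hρ2 hL1 (B := B) (by positivity)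
    (fun n hn => ?_) (fun n hn => ?_) _).trans_eq ?_)
  · simp only [hψ, Nat.cast_add, Nat.cast_one, if_pos hn, le_refl]
  · simp only [hψ, Nat.cast_add, Nat.cast_one, if_neg (not_le.mpr hn), le_refl]
  · rw [hB, Real.mul_rpow (by norm_num) hT]
    ring

end

end FiniteFieldExtension

theorem theorem1p1 (d : ℕ) (hd : 2 ≤ d) (r : ℝ≥0∞)
    (hr : ENNReal.ofReal ((2 * (d : ℝ) + 2) / ((d : ℝ) - 1)) ≤ r) :
    ∃ C : ℝ≥0, ∀ (F : Type*) [Field F] [Fintype F], ringChar F ≠ 2 →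
      ∀ χ : AddChar F ℂ, χ ≠ 1 →
      ∀ A : Matrix (Fin d) (Fin d) F, A.IsSymm → IsUnit A →
      ∀ j : F, j ≠ 0 →
        FiniteFieldExtension.bestConst χ (FiniteFieldExtension.quadSurface A j) 2 r ≤ C := by
  rcases lt_or_ge d 4 with hd4 | hd4
  · -- For `d ≤ 3` the exponent is at least `4`.
    refine ⟨((300 : ℝ) ^ (1 / (2 * (2 : ℝ)))).toNNReal, fun F _ _ hF χ hχ A hA hA' j hj => ?_⟩
    refine iInf₂_le _ (FiniteFieldExtension.extensionEstimate_of_sum_rpow_le (s := 2)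
      (by norm_num) (by norm_num) (fun f => ?_) (le_trans (ENNReal.ofReal_le_ofReal ?_) hr))
    · have h := FiniteFieldExtension.sum_norm_extension_pow_four_le hF hχ hd hA hA' hj f
      norm_num
      exact_mod_cast h
    · have h1 : (d : ℝ) ≤ 3 := by exact_mod_cast (by omega : d ≤ 3)
      have h2 : (2 : ℝ) ≤ d := by exact_mod_cast hd
      rw [le_div_iff₀ (by linarith)]
      linarith
  · set ρ : ℝ := ((d : ℝ) + 1) / ((d : ℝ) - 1) with hρ
    have hd4' : (4 : ℝ) ≤ d := by exact_mod_cast hd4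
    have hd1 : 0 < (d : ℝ) - 1 := by linarith
    have hρ1 : 0 < ρ - 1 := by rw [sub_pos, hρ, one_lt_div hd1]; linarith
    have hρ2 : 0 < 1 - ρ / 2 := by
      have : ρ < 2 := by rw [hρ, div_lt_iff₀ hd1]; linarith
      linarith
    refine ⟨((60 ^ ρ * (1 + 1 / (ρ - 1) + 1 / (1 - ρ / 2) + 2 ^ (ρ - 1) / (ρ - 1)))
      ^ (1 / (2 * ρ))).toNNReal, fun F _ _ hF χ hχ A hA hA' j hj => ?_⟩
    refine iInf₂_le _ (FiniteFieldExtension.extensionEstimate_of_sum_rpow_le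
      (by linarith) (by positivity) (fun f => ?_) (le_trans (le_of_eq ?_) hr))
    · exact FiniteFieldExtension.sum_norm_extension_rpow_le hF hχ hd4 hA hA' hj hρ f
    · congr 1
      rw [hρ]; ring
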